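/- **Conventions.** All matroids are finite. For a matroid $M$ on $E$ and a flat $F$, let $M^F$ be the restriction of $M$ to $F$ and $M_F$ the contraction of $M$ by $F$; $\chi_M(t)=\sum_F \mu(\hat 0,F)\,t^{\mathrm{rk}(M)-\mathrm{rk}(F)}$ is the characteristic polynomial of the lattice of flats of $M$. The inverse Kazhdan–Lusztig polynomials $Q_M(t)\in\mathbb{Z}[t]$ are the unique assignment of a polynomial to each matroid such that: if $\mathrm{rk}(M)=0$, then $Q_M=1$ when $E=\varnothing$ and $Q_M=0$ otherwise; if $\mathrm{rk}(M)>0$, then $\deg Q_M<\mathrm{rk}(M)/2$; and for every $M$ $$(-t)^{\mathrm{rk}(M)}Q_M(t^{-1})=\sum_{F\text{ flat of }M}(-1)^{\mathrm{rk}(F)}\,Q_{M^F}(t)\;t^{\mathrm{rk}(M)-\mathrm{rk}(F)}\chi_{M_F}(t^{-1}).$$ A hyperplane $H$ of a matroid $M$ of rank $k$ is *stressed* if every subset of $H$ of cardinality $k$ is a circuit. Its *relaxation* $\widetilde M$ is the matroid whose bases are the bases of $M$ together with all subsets of $H$ of cardinality $k$. For $a\ge 1$ and $i,b\ge 0$ consider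 the top-aligned diagram that consists, from left to right, of one column of height $a$, then $i$ columns of height $2$, then $b$ columns of height $1$. Let $\mathrm{syt}(a,i,b)$ be the number of standard Young tableaux of this shape, that is, of fillings by $1,\dots,a+2i+b$, each used once, that strictly increase along rows and down columns (this number is $0$ if $a=1$ and $i>0$, as the diagram is then not a Young diagram). Let $\overline{\mathrm{syt}}(a,i,b)$ be the number of those tableaux whose maximal entry is at the bottom of the first or of the $(i+1)$-th column. **Theorem.** (1) For all integers $0\le k\le n$ with $n\ge 1$, the uniform matroid $U_{k,n}$ of rank $k$ on $n$ elements satisfies $$Q_{U_{k,n}}(t)=\sum_{i=0}^{\lfloor (k-1)/2\rfloor}\mathrm{syt}(n-k+1,\,i,\,k-2i-1)\,t^i$$ (the sum is empty for $k=0$). (2) Let $k,h\ge 1$ be integers with $h\ge k-1$. There is exactly one polynomial $q_{k,h}(t)\in\mathbb{Z}[t]$ such that $Q_{\widetilde M}(t)=Q_M(t)+q_{k,h}(t)$ for every matroid $M$ of rank $k$ and every stressed hyperplane $H$ of $M$ of cardinality $h$, where $\widetilde M$ is the relaxation of $H$ in $M$. It is given by $$q_{k,h}(t)=\sum_{i=0}^{\lfloor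 (k-1)/2\rfloor}\overline{\mathrm{syt}}(h-k+2,\,i,\,k-2i-1)\,t^i ,$$ and its coefficients are non-negative. If $h\ge k$, then its degree is $\lfloor (k-1)/2\rfloor$. -/

import Mathlib

open Polynomial

universe u

noncomputable section

namespace MatroidKL

section Matroids

variable {α : Type u} [Finite α]

/-- The rank of a set in a matroid on a finite type, as a natural number. -/
def rk (M : Matroid α) (X : Set α) : ℕ := (M.eRk X).toNat

/-- The rank of a matroid. -/
def rank (M : Matroid α) : ℕ := rk M M.E

/-- The lattice of flats, ordered by inclusion. -/
abbrev Flats (M : Matroid α) : Type u := {F : Set α // M.IsFlat F}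

/-- The smallest flat, consisting of the loops. -/
def botFlat (M : Matroid α) : Flats M := ⟨M.closure ∅, M.isFlat_closure ∅⟩

open Classical in
/-- The Möbius function of the lattice of flats. -/
def moebius (M : Matroid α) (F G : Flats M) : ℤ :=
  letI : Fintype (Flats M) := Fintype.ofFinite _
  letI : LocallyFiniteOrder (Flats M) := Fintype.toLocallyFiniteOrder
  IncidenceAlgebra.mu ℤ F G

/-- The characteristic polynomial of the lattice of flats,
`χ_M(t) = ∑_F μ(0̂, F) t ^ (rk M - rk F)`. -/
def charPoly (M : Matroid α) : ℤ[X] :=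
  ∑ᶠ F : Flats M, C (moebius M (botFlat M) F) * X ^ (rank M - rk M F.1)

/-- The three conditions which determine the inverse Kazhdan–Lusztig polynomials. The localization
of `M` at a flat `F` is `M.restrict F`, the contraction of `M` by `F` is `M.contract F`, and
`reflect d p` is `t ^ d * p(t⁻¹)` for a polynomial `p` of degree at most `d`. -/
structure IsInverseKL (Q : Matroid α → ℤ[X]) : Prop where
  rank_zero_of_empty : ∀ M : Matroid α, rank M = 0 → M.E = ∅ → Q M = 1
  rank_zero_of_nonempty : ∀ M : Matroid α, rank M = 0 → M.E.Nonempty → Q M = 0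
  degree_lt : ∀ M : Matroid α, 0 < rank M → 2 * (Q M).natDegree < rank M
  recursion : ∀ M : Matroid α,
    (-1) ^ rank M * reflect (rank M) (Q M) =
      ∑ᶠ F : Flats M, (-1) ^ rk M F.1 * Q (M.restrict F.1) *
        reflect (rank M - rk M F.1) (charPoly (M.contract F.1))

/-- The inverse Kazhdan–Lusztig polynomial `Q_M`: the value at `M` of the (unique) assignment
of polynomials to matroids that satisfies the three conditions of `IsInverseKL`. -/
def inverseKL (M : Matroid α) : ℤ[X] :=
  Classical.epsilon (fun Q : Matroid α → ℤ[X] => IsInverseKL Q) M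

/-- A stressed hyperplane: a flat of corank one all of whose subsets of cardinality `rank M`
are circuits. -/
structure IsStressedHyperplane (M : Matroid α) (H : Set α) : Prop where
  isFlat : M.IsFlat H
  rk_add_one : rk M H + 1 = rank M
  isCircuit : ∀ S ⊆ H, S.ncard = rank M → M.IsCircuit S

theorem ncard_of_isBase {M : Matroid α} {B : Set α} (hB : M.IsBase B) : B.ncard = rank M := by
  rw [rank, rk, M.eRk_ground, ← hB.eRk_eq_eRank, hB.indep.eRk_eq_encard, Set.ncard_def]

theorem isBase_of_indep_of_ncard {M : Matroid α} {I : Set α} (hI : M.Indep I)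
    (h : I.ncard = rank M) : M.IsBase I := by
  obtain ⟨B, hB, hIB⟩ := hI.exists_isBase_superset
  have : I = B := Set.eq_of_subset_of_ncard_le hIB (by rw [ncard_of_isBase hB, h]) (Set.toFinite _)
  exact this ▸ hB

theorem exists_mem_diff_of_ncard_eq {X Y : Set α} (h : X.ncard = Y.ncard) {a : α}
    (ha : a ∈ X \ Y) : ∃ b, b ∈ Y \ X := by
  by_contra hcon
  push Not at hcon
  have hYX : Y ⊆ X := fun b hb => by
    by_contra hbX
    exact hcon b ⟨hb, hbX⟩
  have : Y = X := Set.eq_of_subset_of_ncard_le hYX h.le (Set.toFinite _)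
  exact ha.2 (this ▸ ha.1)

theorem ncard_exchange {X : Set α} {a b : α} (ha : a ∈ X) (hb : b ∉ X) :
    (insert b (X \ {a})).ncard = X.ncard := by
  rw [Set.ncard_insert_of_notMem (fun h => hb h.1) (Set.toFinite _)]
  exact Set.ncard_sdiff_singleton_add_one ha (Set.toFinite _)

theorem relax_exchange {M : Matroid α} {H : Set α} (hH : IsStressedHyperplane M H) :
    Matroid.ExchangeProperty
      (fun B => M.IsBase B ∨ (B ⊆ H ∧ B.ncard = rank M)) := by
  have card_eq : ∀ B : Set α, (M.IsBase B ∨ (B ⊆ H ∧ B.ncard = rank M)) → B.ncard = rank M := by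
    rintro B (hB | hB)
    · exact ncard_of_isBase hB
    · exact hB.2
  intro X Y hX hY a ha
  have hXk := card_eq X hX
  have hYk := card_eq Y hY
  -- if the remaining part of `X` and all of `Y` lie in `H`, any exchange works
  have easy : X \ {a} ⊆ H → Y ⊆ H → ∃ b ∈ Y \ X, M.IsBase (insert b (X \ {a})) ∨
      (insert b (X \ {a}) ⊆ H ∧ (insert b (X \ {a})).ncard = rank M) := by
    intro h1 h2
    obtain ⟨b, hb⟩ := exists_mem_diff_of_ncard_eq (hXk.trans hYk.symm) ha
    exact ⟨b, hb, Or.inr ⟨Set.insert_subset (h2 hb.1) h1, by rw [ncard_exchange ha.1 hb.2, hXk]⟩⟩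
  -- an element of `Y` outside the closure of `X \ {a}` can be used for the exchange
  have key : M.Indep (X \ {a}) → (∃ b ∈ Y, b ∈ M.E ∧ b ∉ M.closure (X \ {a})) →
      ∃ b ∈ Y \ X, M.IsBase (insert b (X \ {a})) ∨
        (insert b (X \ {a}) ⊆ H ∧ (insert b (X \ {a})).ncard = rank M) := by
    rintro hI ⟨b, hbY, hbE, hb⟩
    have hb' : b ∉ X \ {a} := fun h => hb (M.subset_closure _ hI.subset_ground h)
    have hbX : b ∉ X := fun h => hb' ⟨h, fun hba => ha.2 (by
      rw [Set.mem_singleton_iff] at hba; exact hba ▸ hbY)⟩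
    refine ⟨b, ⟨hbY, hbX⟩, Or.inl (isBase_of_indep_of_ncard ?_ ?_)⟩
    · exact (hI.insert_indep_iff.2 (Or.inl ⟨hbE, hb⟩))
    · rw [ncard_exchange ha.1 hbX, hXk]
  rcases hX with hX | ⟨hXH, -⟩
  · rcases hY with hY | ⟨hYH, -⟩
    · obtain ⟨b, hb, hb'⟩ := hX.exchange hY ha
      exact ⟨b, hb, Or.inl hb'⟩
    · by_cases hsub : X \ {a} ⊆ H
      · exact easy hsub hYH
      · have hI : M.Indep (X \ {a}) := hX.indep.subset Set.sdiff_subset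
        apply key hI
        by_contra hcon
        push Not at hcon
        have hYE : Y ⊆ M.E := hYH.trans hH.isFlat.subset_ground
        have hYcl : Y ⊆ M.closure (X \ {a}) := fun b hb => hcon b hb (hYE hb)
        obtain ⟨e, heX, heH⟩ := Set.not_subset.1 hsub
        have hC := hH.isCircuit Y hYH hYk
        obtain ⟨y, hy⟩ := hC.nonempty
        have hJ : M.Indep (Y \ {y}) := hC.sdiff_singleton_indep hy
        have heE : e ∈ M.E := hI.subset_ground heX
        have hecl : e ∉ M.closure (Y \ {y}) := fun h => heH (by
          have := M.closure_subset_closure (Set.sdiff_subset.trans hYH : Y \ {y} ⊆ H) h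
          rwa [hH.isFlat.closure] at this)
        have hJe : M.Indep (insert e (Y \ {y})) := hJ.insert_indep_iff.2 (Or.inl ⟨heE, hecl⟩)
        have hsub2 : insert e (Y \ {y}) ⊆ M.closure (X \ {a}) :=
          Set.insert_subset (M.subset_closure _ hI.subset_ground heX)
            (Set.sdiff_subset.trans hYcl)
        have hle := hJe.encard_le_eRk_of_subset hsub2
        rw [M.eRk_closure_eq, hI.eRk_eq_encard, ← (Set.toFinite _).cast_ncard_eq,
          ← (Set.toFinite _).cast_ncard_eq, Nat.cast_le,
          ncard_exchange hy (fun h => heH (hYH h)), hYk] at hle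
        have := Set.ncard_sdiff_singleton_add_one ha.1 (Set.toFinite X)
        omega
  · rcases hY with hY | ⟨hYH, -⟩
    · have hC := hH.isCircuit X hXH hXk
      have hI : M.Indep (X \ {a}) := hC.sdiff_singleton_indep ha.1
      apply key hI
      by_contra hcon
      push Not at hcon
      have hYcl : Y ⊆ M.closure (X \ {a}) := fun b hb => hcon b hb (hY.subset_ground hb)
      have hle := hY.indep.encard_le_eRk_of_subset hYcl
      rw [M.eRk_closure_eq, hI.eRk_eq_encard, ← (Set.toFinite _).cast_ncard_eq,
          ← (Set.toFinite _).cast_ncard_eq, Nat.cast_le, hYk] at hle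
      have := Set.ncard_sdiff_singleton_add_one ha.1 (Set.toFinite X)
      omega
    · exact easy (Set.sdiff_subset.trans hXH) hYH

/-- The relaxation of a stressed hyperplane `H`: the bases are those of `M` together with
all subsets of `H` of cardinality `rank M`. -/
def relax (M : Matroid α) (H : Set α) (hH : IsStressedHyperplane M H) : Matroid α :=
  Matroid.ofIsBaseOfFinite (E := M.E) (Set.toFinite _)
    (fun B => M.IsBase B ∨ (B ⊆ H ∧ B.ncard = rank M))
    (M.exists_isBase.imp fun _ h => Or.inl h)
    (relax_exchange hH)
    (by
      rintro B (hB | hB)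
      · exact hB.subset_ground
      · exact hB.1.trans hH.isFlat.subset_ground)

end Matroids

/-- The uniform matroid `U_{k,n}` on `n` elements, whose bases are the sets of cardinality `k`. -/
def uniform (k n : ℕ) (hkn : k ≤ n) : Matroid (Fin n) :=
  Matroid.ofIsBaseOfFinite (E := Set.univ) (Set.toFinite _) (fun B => B.ncard = k)
    (by
      obtain ⟨s, -, hs⟩ := Finset.exists_subset_card_eq
        (s := (Finset.univ : Finset (Fin n))) (n := k) (by simpa using hkn)
      exact ⟨(s : Set (Fin n)), by rw [Set.ncard_coe_finset, hs]⟩)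
    (fun X Y hX hY a ha => by
      obtain ⟨b, hb⟩ := exists_mem_diff_of_ncard_eq (hX.trans hY.symm) ha
      exact ⟨b, hb, (ncard_exchange ha.1 hb.2).trans hX⟩)
    (fun _ _ => Set.subset_univ _)

/-- The property that characterizes `q_{k,h}`: for every matroid `M` of rank `k`, relaxing a
stressed hyperplane of cardinality `h` changes the inverse Kazhdan–Lusztig polynomial by `q`. -/
def IsRelaxationPolynomial (k h : ℕ) (q : ℤ[X]) : Prop :=
  ∀ (α : Type u) [Finite α] (M : Matroid α) (H : Set α) (hH : IsStressedHyperplane M H),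
    rank M = k → H.ncard = h → inverseKL (relax M H hH) = inverseKL M + q

section Tableaux

/-- The boxes (row, column), numbered from `0`, of the diagram which consists of a column of
height `a`, then `i` columns of height `2`, then `b` columns of height `1`, all aligned
at the top. -/
def sytCells (a i b : ℕ) : Finset (ℕ × ℕ) :=
  (Finset.range a ×ˢ {0}) ∪ (Finset.range 2 ×ˢ Finset.Ico 1 (1 + i)) ∪
    ({0} ×ˢ Finset.Ico (1 + i) (1 + i + b))

/-- The standard Young tableaux of this shape, as functions which are `0` outside the shape.
There are none if the boxes do not form a Young diagram (as for `a = 1` and `i > 0`). -/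
def Syt (a i b : ℕ) : Set (ℕ × ℕ → ℕ) :=
  {T | IsLowerSet (sytCells a i b : Set (ℕ × ℕ)) ∧
    (∀ c, c ∉ sytCells a i b → T c = 0) ∧
    Set.BijOn T (sytCells a i b) (Set.Icc 1 (a + 2 * i + b)) ∧
    (∀ r c c', c < c' → (r, c) ∈ sytCells a i b → (r, c') ∈ sytCells a i b →
      T (r, c) < T (r, c')) ∧
    (∀ r r' c, r < r' → (r, c) ∈ sytCells a i b → (r', c) ∈ sytCells a i b →
      T (r, c) < T (r', c))}

/-- The tableaux whose maximal entry is at the bottom of the first or of the `(i+1)`-th column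
(the columns with index `0` and `i`). -/
def SytBar (a i b : ℕ) : Set (ℕ × ℕ → ℕ) :=
  {T | T ∈ Syt a i b ∧ ∃ r c, (c = 0 ∨ c = i) ∧ (r, c) ∈ sytCells a i b ∧
    (r + 1, c) ∉ sytCells a i b ∧ T (r, c) = a + 2 * i + b}

def syt (a i b : ℕ) : ℕ := (Syt a i b).ncard

def sytBar (a i b : ℕ) : ℕ := (SytBar a i b).ncard

end Tableaux

end MatroidKL

end

set_option linter.unusedSectionVars false

/-! Let r = rk M, and let S_M (`properSum`) be the part of the recursion that belongs to the proper
flats. The flat E contributes (-1)^r Q_M, so the recursion says (-1)^r (t^r Q_M(1/t) - Q_M(t)) =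
S_M(t). For r > 0 the bound deg Q_M < r/2 separates the two terms on the left: below degree r/2 the
coefficients of Q_M are those of (-1)^(r+1) S_M (`coeff_inverseKL`). Conversely, Q exists because
t^r S_M(1/t) = -S_M(t), which follows inductively from the kernel identity `sum_chiRev_mul_chi`.
Characteristic polynomials are expanded over all subsets instead of flats (Whitney), so that only
rank functions enter.

Write A(n,k,i) = ∑_{m<k} (-1)^m C(n,m) C(m,i) (`altSum`). A proper flat of U_{k,n} is a set F with
fewer than k elements; its restriction is Boolean, with Q = 1. Counting pairs F ⊆ A shows that t^i
has coefficient A(n,k,i) - A(n,k,k-i) in S (`IsUniform.coeff_properSum`). These sums have a closed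
product form, and the resulting difference of products satisfies the recursion for tableaux that
removes the largest entry (`syt_succ`, `syt_eq_altSum`).

Let H be stressed of cardinality h ≥ k = rk M. Relaxation changes only the flats inside H and the
ranks of subsets of H with at least k elements. The flat H, whose restriction is U_{k-1,h}, gives
way to C(h,k-1) Boolean hyperplanes. The difference of the two sums S is (t-1)W, where W has
coefficient -A(h,k,j) in every degree j < k/2. Hence the coefficient of t^i in Q changes by
(-1)^(k+1) (A(h,k,i) - A(h,k,i-1)), the second term being absent for i = 0. This counts the tableaux
whose maximum is at one of the two permitted corners (`sytBar_eq_altSum`). A coloop added to a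
uniform matroid provides a stressed hyperplane for all admissible k and h, which makes q unique. -/

noncomputable section
namespace MatroidKL

/-! ### Standard fillings and removal of the largest entry -/

section Fillings

/-- The bijective fillings of a diagram `D` by `1, …, N`, increasing along rows and columns. -/
def fillings (D : Finset (ℕ × ℕ)) (N : ℕ) : Set (ℕ × ℕ → ℕ) :=
  {T | IsLowerSet (D : Set (ℕ × ℕ)) ∧
    (∀ c, c ∉ D → T c = 0) ∧
    Set.BijOn T D (Set.Icc 1 N) ∧
    (∀ r c c', c < c' → (r, c) ∈ D → (r, c') ∈ D → T (r, c) < T (r, c')) ∧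
    (∀ r r' c, r < r' → (r, c) ∈ D → (r', c) ∈ D → T (r, c) < T (r', c))}

theorem syt_eq_ncard_fillings (a i b : ℕ) :
    syt a i b = (fillings (sytCells a i b) (a + 2 * i + b)).ncard := rfl

theorem ncard_fillings_sytCells {a i b N : ℕ} (h : N = a + 2 * i + b) :
    (fillings (sytCells a i b) N).ncard = syt a i b := by
  rw [h, syt_eq_ncard_fillings]

theorem fillings_eq_empty {D : Finset (ℕ × ℕ)} (hD : ¬ IsLowerSet (D : Set (ℕ × ℕ))) (N : ℕ) :
    fillings D N = ∅ := by
  ext T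
  simp [fillings, hD]

theorem lt_of_mem_fillings {D : Finset (ℕ × ℕ)} {N : ℕ} {T : ℕ × ℕ → ℕ} (hT : T ∈ fillings D N)
    {c d : ℕ × ℕ} (hd : d ∈ D) (hcd : c < d) : T c < T d := by
  obtain ⟨hlow, -, -, hrow, hcol⟩ := hT
  obtain ⟨r, s⟩ := c
  obtain ⟨r', s'⟩ := d
  have hle : r ≤ r' ∧ s ≤ s' := Prod.mk_le_mk.1 hcd.le
  have h1 : (r, s') ∈ D := hlow (Prod.mk_le_mk.2 ⟨hle.1, le_rfl⟩ : (r, s') ≤ (r', s')) hd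
  have h2 : (r, s) ∈ D := hlow (Prod.mk_le_mk.2 ⟨le_rfl, hle.2⟩ : (r, s) ≤ (r, s')) h1
  rcases hle.1.lt_or_eq with h | rfl
  · rcases hle.2.lt_or_eq with h' | rfl
    · exact (hrow _ _ _ h' h2 h1).trans (hcol _ _ _ h h1 hd)
    · exact hcol _ _ _ h h1 hd
  · rcases hle.2.lt_or_eq with h' | rfl
    · exact hrow _ _ _ h' h2 hd
    · exact absurd hcd (lt_irrefl _)

theorem isLowerSet_erase_of_max {D : Finset (ℕ × ℕ)} {N : ℕ} {T : ℕ × ℕ → ℕ}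
    (hT : T ∈ fillings D N) {c : ℕ × ℕ} (hc : T c = N) :
    IsLowerSet ((D.erase c : Finset (ℕ × ℕ)) : Set (ℕ × ℕ)) := by
  intro e d hde he
  simp only [Finset.coe_erase, Set.mem_sdiff, Finset.mem_coe, Set.mem_singleton_iff] at he ⊢
  refine ⟨hT.1 hde he.1, ?_⟩
  rintro rfl
  have h1 := lt_of_mem_fillings hT he.1 (lt_of_le_of_ne hde (Ne.symm he.2))
  have h2 := (hT.2.2.1.mapsTo he.1).2
  omega

/-- Erasing the largest entry and putting it back are inverse to each other. The box `c` need not be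
a corner: otherwise `D.erase c` is no lower set and both sides are empty, because `fillings`
contains the diagram condition. -/
theorem setOf_fillings_max {D : Finset (ℕ × ℕ)} (hD : IsLowerSet (D : Set (ℕ × ℕ))) (N : ℕ)
    {c : ℕ × ℕ} (hc : c ∈ D) :
    {T | T ∈ fillings D (N + 1) ∧ T c = N + 1} =
      (fun T => Function.update T c (N + 1)) '' fillings (D.erase c) N := by
  ext T
  constructor
  · rintro ⟨hT, hTc⟩
    refine ⟨Function.update T c 0, ⟨isLowerSet_erase_of_max hT hTc, ?_, ?_, ?_, ?_⟩, ?_⟩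
    · intro d hd
      by_cases hdc : d = c
      · simp [hdc]
      · rw [Function.update_of_ne hdc]
        exact hT.2.1 d (fun h => hd (Finset.mem_erase.2 ⟨hdc, h⟩))
    · have hbij := hT.2.2.1.sdiff_singleton (a := c) hc
      rw [hTc] at hbij
      rw [Finset.coe_erase]
      have : Set.Icc 1 (N + 1) \ {N + 1} = Set.Icc 1 N := by
        ext x; simp only [Set.mem_sdiff, Set.mem_Icc, Set.mem_singleton_iff]; omega
      rw [this] at hbij
      refine hbij.congr ?_
      intro d hd
      exact (Function.update_of_ne hd.2 _ _).symm
    · intro r s s' h h1 h2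
      rw [Finset.mem_erase] at h1 h2
      rw [Function.update_of_ne h1.1, Function.update_of_ne h2.1]
      exact hT.2.2.2.1 _ _ _ h h1.2 h2.2
    · intro r s s' h h1 h2
      rw [Finset.mem_erase] at h1 h2
      rw [Function.update_of_ne h1.1, Function.update_of_ne h2.1]
      exact hT.2.2.2.2 _ _ _ h h1.2 h2.2
    · simp [← hTc]
  · rintro ⟨T, hT, rfl⟩
    have hval : ∀ d ∈ D, d ≠ c → T d < N + 1 := fun d hd hdc =>
      Nat.lt_succ_of_le (hT.2.2.1.mapsTo (by simpa using ⟨hd, hdc⟩ : d ∈ (D.erase c : Set _))).2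
    have key : ∀ d e : ℕ × ℕ, d < e → d ∈ D → e ∈ D →
        Function.update T c (N + 1) d < Function.update T c (N + 1) e := by
      intro d e hde hd he
      have hdc : d ≠ c := by
        rintro rfl
        have := hT.1 hde.le (by simpa using ⟨he, hde.ne'⟩)
        simp at this
      rw [Function.update_of_ne hdc]
      by_cases hec : e = c
      · subst hec
        simpa using hval d hd hdc
      · rw [Function.update_of_ne hec]
        exact lt_of_mem_fillings hT (Finset.mem_erase.2 ⟨hec, he⟩) hde
    refine ⟨⟨hD, ?_, ?_, ?_, ?_⟩, by simp⟩
    · intro d hd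
      have hdc : d ≠ c := by rintro rfl; exact hd hc
      simp only [Function.update_of_ne hdc]
      exact hT.2.1 d (fun h => hd (Finset.mem_of_mem_erase h))
    · have hbij : Set.BijOn (Function.update T c (N + 1)) (D.erase c : Finset _) (Set.Icc 1 N) :=
        hT.2.2.1.congr (fun d hd => (Function.update_of_ne (by
          rintro rfl; simp at hd) _ _).symm)
      have h2 := hbij.insert (a := c) (by simp)
      rw [Function.update_self, ← Finset.coe_insert, Finset.insert_erase hc] at h2
      convert h2 using 1
      ext x; simp only [Set.mem_Icc, Set.mem_insert_iff]; omega
    · intro r s s' h h1 h2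
      exact key _ _ (Prod.mk_lt_mk.2 (Or.inr ⟨le_rfl, h⟩)) h1 h2
    · intro r s s' h h1 h2
      exact key _ _ (Prod.mk_lt_mk.2 (Or.inl ⟨h, le_rfl⟩)) h1 h2

theorem ncard_fillings_max {D : Finset (ℕ × ℕ)} (hD : IsLowerSet (D : Set (ℕ × ℕ))) (N : ℕ)
    {c : ℕ × ℕ} (hc : c ∈ D) :
    {T | T ∈ fillings D (N + 1) ∧ T c = N + 1}.ncard = (fillings (D.erase c) N).ncard := by
  rw [setOf_fillings_max hD N hc]
  refine Set.InjOn.ncard_image ?_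
  intro T hT T' hT' h
  funext d
  by_cases hdc : d = c
  · subst hdc
    rw [hT.2.1 d (by simp), hT'.2.1 d (by simp)]
  · have := congrFun h d
    simpa [hdc] using this

theorem exists_max {D : Finset (ℕ × ℕ)} {N : ℕ} {T : ℕ × ℕ → ℕ} (hT : T ∈ fillings D (N + 1)) :
    ∃ c ∈ D, T c = N + 1 := hT.2.2.1.surjOn (by simp : N + 1 ∈ Set.Icc 1 (N + 1))

/-- Finiteness is what makes `Set.ncard` additive when fillings are sorted by the position of their
maximum. -/
theorem finite_fillings (D : Finset (ℕ × ℕ)) (N : ℕ) : (fillings D N).Finite := by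
  induction N generalizing D with
  | zero =>
    refine (Set.finite_singleton (0 : ℕ × ℕ → ℕ)).subset ?_
    intro T hT
    have hD : ∀ d, d ∉ D := fun d hd => by simpa using hT.2.2.1.mapsTo hd
    exact funext fun d => hT.2.1 d (hD d)
  | succ N ih =>
    by_cases hD : IsLowerSet (D : Set (ℕ × ℕ))
    · refine ((D.finite_toSet).biUnion (t := fun c => {T | T ∈ fillings D (N + 1) ∧ T c = N + 1})
        ?_).subset ?_
      · intro c hc
        rw [setOf_fillings_max hD N hc]
        exact (ih _).image _
      · intro T hT
        obtain ⟨c, hc, h⟩ := exists_max hT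
        exact Set.mem_biUnion (Finset.mem_coe.2 hc) ⟨hT, h⟩
    · rw [fillings_eq_empty hD]
      exact Set.finite_empty

theorem ncard_fillings_max_mem {D : Finset (ℕ × ℕ)} (hD : IsLowerSet (D : Set (ℕ × ℕ))) (N : ℕ)
    {S : Finset (ℕ × ℕ)} (hS : S ⊆ D) :
    {T | T ∈ fillings D (N + 1) ∧ ∃ c ∈ S, T c = N + 1}.ncard =
      ∑ c ∈ S, (fillings (D.erase c) N).ncard := by
  induction S using Finset.induction_on with
  | empty => simp
  | insert c S hcS ih =>
    rw [Finset.sum_insert hcS, ← ih (fun x hx => hS (Finset.mem_insert_of_mem hx)),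
      ← ncard_fillings_max hD N (hS (Finset.mem_insert_self _ _)),
      ← Set.ncard_union_eq ?_ ((finite_fillings _ _).subset fun T hT => hT.1)
        ((finite_fillings _ _).subset fun T hT => hT.1)]
    · congr 1
      ext T
      simp only [Finset.mem_insert, exists_eq_or_imp, Set.mem_ofPred_eq, Set.mem_union]
      tauto
    · rw [Set.disjoint_left]
      rintro T ⟨hT, hc⟩ ⟨-, d, hd, hd'⟩
      have := hT.2.2.1.injOn (hS (Finset.mem_insert_self _ _))
        (hS (Finset.mem_insert_of_mem hd)) (hc.trans hd'.symm)
      exact hcS (this ▸ hd)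

/-- Removing the maximal entry, where `S` contains all corners of the diagram. -/
theorem ncard_fillings_succ {D : Finset (ℕ × ℕ)} (hD : IsLowerSet (D : Set (ℕ × ℕ))) (N : ℕ)
    {S : Finset (ℕ × ℕ)} (hS : S ⊆ D)
    (hcorner : ∀ c ∈ D, c ∉ S → ∃ d ∈ D, c < d) :
    (fillings D (N + 1)).ncard = ∑ c ∈ S, (fillings (D.erase c) N).ncard := by
  rw [← ncard_fillings_max_mem hD N hS]
  congr 1
  ext T
  refine ⟨fun hT => ⟨hT, ?_⟩, fun hT => hT.1⟩
  obtain ⟨c, hc, h⟩ := exists_max hT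
  by_contra hcon
  obtain ⟨d, hd, hcd⟩ := hcorner c hc (fun hcS => hcon ⟨c, hcS, h⟩)
  have h1 := lt_of_mem_fillings hT hd hcd
  have h2 := (hT.2.2.1.mapsTo hd).2
  omega

end Fillings

/-! ### Recursions and closed formulas for the tableau counts -/

section Shapes

theorem mem_sytCells {a i b r c : ℕ} : (r, c) ∈ sytCells a i b ↔
    (c = 0 ∧ r < a) ∨ (1 ≤ c ∧ c < 1 + i ∧ r < 2) ∨ (1 + i ≤ c ∧ c < 1 + i + b ∧ r = 0) := by
  simp only [sytCells, Finset.mem_union, Finset.mem_product, Finset.mem_range,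
    Finset.mem_singleton, Finset.mem_Ico]
  tauto

theorem isLowerSet_sytCells {a i b : ℕ} (h : 2 ≤ a ∨ (1 ≤ a ∧ i = 0)) :
    IsLowerSet (sytCells a i b : Set (ℕ × ℕ)) := by
  rintro ⟨r, c⟩ ⟨r', c'⟩ hle hmem
  have hle' := Prod.mk_le_mk.1 hle
  rw [Finset.mem_coe, mem_sytCells] at hmem ⊢
  omega

theorem sytCells_erase_first (a i b : ℕ) :
    (sytCells (a + 1) i b).erase (a, 0) = sytCells a i b := by
  ext ⟨r, c⟩
  rw [Finset.mem_erase, mem_sytCells, mem_sytCells, Ne, Prod.mk.injEq]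
  omega

theorem sytCells_erase_second (a i b : ℕ) :
    (sytCells a (i + 1) b).erase (1, i + 1) = sytCells a i (b + 1) := by
  ext ⟨r, c⟩
  rw [Finset.mem_erase, mem_sytCells, mem_sytCells, Ne, Prod.mk.injEq]
  omega

theorem sytCells_erase_third (a i b : ℕ) :
    (sytCells a i (b + 1)).erase (0, i + b + 1) = sytCells a i b := by
  ext ⟨r, c⟩
  rw [Finset.mem_erase, mem_sytCells, mem_sytCells, Ne, Prod.mk.injEq]
  omega

theorem syt_one_succ (i b : ℕ) : syt 1 (i + 1) b = 0 := by
  rw [syt_eq_ncard_fillings, fillings_eq_empty, Set.ncard_empty]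
  intro h
  have h1 : ((1, 1) : ℕ × ℕ) ∈ (sytCells 1 (i + 1) b : Set (ℕ × ℕ)) := by
    rw [Finset.mem_coe, mem_sytCells]; omega
  have := h (Prod.mk_le_mk.2 ⟨le_rfl, zero_le_one⟩ : ((1, 0) : ℕ × ℕ) ≤ (1, 1)) h1
  rw [Finset.mem_coe, mem_sytCells] at this
  omega

theorem syt_one_zero_zero : syt 1 0 0 = 1 := by
  rw [syt_eq_ncard_fillings, ncard_fillings_succ (N := 0) (S := {(0, 0)})
    (isLowerSet_sytCells (by omega))]
  · rw [Finset.sum_singleton, sytCells_erase_first]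
    have : fillings (sytCells 0 0 0) 0 = {0} := by
      ext T
      rw [Set.mem_singleton_iff]
      refine ⟨fun hT => funext fun c => hT.2.1 c (by rw [mem_sytCells]; omega), ?_⟩
      rintro rfl
      have : sytCells 0 0 0 = ∅ := by
        ext ⟨r, c⟩; rw [mem_sytCells]; simp; omega
      rw [this]
      simp [fillings, isLowerSet_empty]
    rw [this, Set.ncard_singleton]
  · intro c hc
    rw [Finset.mem_singleton] at hc
    rw [hc, mem_sytCells]; omega
  · rintro ⟨r, c⟩ hc hS
    rw [Finset.mem_singleton, Prod.mk.injEq] at hS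
    rw [mem_sytCells] at hc; omega

theorem syt_one_zero_succ (b : ℕ) : syt 1 0 (b + 1) = syt 1 0 b := by
  rw [← ncard_fillings_sytCells (N := 1 + 2 * 0 + b + 1) (by ring), ncard_fillings_succ (S := {(0, 0 + b + 1)})
    (isLowerSet_sytCells (by omega))]
  · rw [Finset.sum_singleton, sytCells_erase_third, ncard_fillings_sytCells (by ring)]
  · intro c hc
    rw [Finset.mem_singleton] at hc
    rw [hc, mem_sytCells]; omega
  · rintro ⟨r, c⟩ hc hS
    rw [Finset.mem_singleton, Prod.mk.injEq] at hS
    rw [mem_sytCells] at hc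
    refine ⟨(0, 0 + b + 1), by rw [mem_sytCells]; omega, Prod.mk_lt_mk.2 ?_⟩
    omega

theorem syt_one_zero (b : ℕ) : syt 1 0 b = 1 := by
  induction b with
  | zero => exact syt_one_zero_zero
  | succ b ih => rw [syt_one_zero_succ, ih]

theorem syt_zero_zero (a : ℕ) : syt (a + 2) 0 0 = syt (a + 1) 0 0 := by
  rw [← ncard_fillings_sytCells (N := a + 1 + 2 * 0 + 0 + 1) (by ring), ncard_fillings_succ (S := {(a + 1, 0)})
    (isLowerSet_sytCells (by omega))]
  · rw [Finset.sum_singleton, sytCells_erase_first, ncard_fillings_sytCells (by ring)]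
  · intro c hc
    rw [Finset.mem_singleton] at hc
    rw [hc, mem_sytCells]; omega
  · rintro ⟨r, c⟩ hc hS
    rw [Finset.mem_singleton, Prod.mk.injEq] at hS
    rw [mem_sytCells] at hc
    refine ⟨(a + 1, 0), by rw [mem_sytCells]; omega, Prod.mk_lt_mk.2 ?_⟩
    omega

theorem syt_zero_succ (a b : ℕ) :
    syt (a + 2) 0 (b + 1) = syt (a + 1) 0 (b + 1) + syt (a + 2) 0 b := by
  rw [← ncard_fillings_sytCells (N := a + 2 + 2 * 0 + b + 1) (by ring),
    ncard_fillings_succ (S := {(a + 1, 0), (0, 0 + b + 1)}) (isLowerSet_sytCells (by omega))]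
  · rw [Finset.sum_pair (by simp), sytCells_erase_first, sytCells_erase_third,
      ncard_fillings_sytCells (by ring), ncard_fillings_sytCells (by ring)]
  · intro c hc
    rw [Finset.mem_insert, Finset.mem_singleton] at hc
    rcases hc with rfl | rfl <;> rw [mem_sytCells] <;> omega
  · rintro ⟨r, c⟩ hc hS
    rw [Finset.mem_insert, Finset.mem_singleton, Prod.mk.injEq, Prod.mk.injEq] at hS
    rw [mem_sytCells] at hc
    by_cases h : c = 0 ∧ 0 < r
    · refine ⟨(a + 1, 0), by rw [mem_sytCells]; omega, Prod.mk_lt_mk.2 ?_⟩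
      omega
    · refine ⟨(0, 0 + b + 1), by rw [mem_sytCells]; omega, Prod.mk_lt_mk.2 ?_⟩
      omega

theorem syt_succ_zero (a i : ℕ) :
    syt (a + 2) (i + 1) 0 = syt (a + 1) (i + 1) 0 + syt (a + 2) i 1 := by
  rw [← ncard_fillings_sytCells (N := a + 1 + 2 * (i + 1) + 0 + 1) (by ring),
    ncard_fillings_succ (S := {(a + 1, 0), (1, i + 1)}) (isLowerSet_sytCells (by omega))]
  · rw [Finset.sum_pair (by simp), sytCells_erase_first, sytCells_erase_second,
      ncard_fillings_sytCells (by ring), ncard_fillings_sytCells (by ring)]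
  · intro c hc
    rw [Finset.mem_insert, Finset.mem_singleton] at hc
    rcases hc with rfl | rfl <;> rw [mem_sytCells] <;> omega
  · rintro ⟨r, c⟩ hc hS
    rw [Finset.mem_insert, Finset.mem_singleton, Prod.mk.injEq, Prod.mk.injEq] at hS
    rw [mem_sytCells] at hc
    by_cases h : c = 0
    · refine ⟨(a + 1, 0), by rw [mem_sytCells]; omega, Prod.mk_lt_mk.2 ?_⟩
      omega
    · refine ⟨(1, i + 1), by rw [mem_sytCells]; omega, Prod.mk_lt_mk.2 ?_⟩
      omega

theorem syt_succ_succ (a i b : ℕ) :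
    syt (a + 2) (i + 1) (b + 1) =
      syt (a + 1) (i + 1) (b + 1) + syt (a + 2) i (b + 2) + syt (a + 2) (i + 1) b := by
  rw [← ncard_fillings_sytCells (N := a + 1 + 2 * (i + 1) + (b + 1) + 1) (by ring),
    ncard_fillings_succ (S := {(a + 1, 0), (1, i + 1), (0, i + 1 + b + 1)})
      (isLowerSet_sytCells (by omega))]
  · rw [Finset.sum_insert (by simp), Finset.sum_pair (by simp), sytCells_erase_first,
      sytCells_erase_second, sytCells_erase_third, ncard_fillings_sytCells (by ring),
      ncard_fillings_sytCells (by ring), ncard_fillings_sytCells (by ring)]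
    ring
  · intro c hc
    rw [Finset.mem_insert, Finset.mem_insert, Finset.mem_singleton] at hc
    rcases hc with rfl | rfl | rfl <;> rw [mem_sytCells] <;> omega
  · rintro ⟨r, c⟩ hc hS
    rw [Finset.mem_insert, Finset.mem_insert, Finset.mem_singleton, Prod.mk.injEq,
      Prod.mk.injEq, Prod.mk.injEq] at hS
    rw [mem_sytCells] at hc
    by_cases h : c = 0
    · refine ⟨(a + 1, 0), by rw [mem_sytCells]; omega, Prod.mk_lt_mk.2 ?_⟩
      omega
    · by_cases h1 : c < i + 2
      · refine ⟨(1, i + 1), by rw [mem_sytCells]; omega, Prod.mk_lt_mk.2 ?_⟩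
        omega
      · refine ⟨(0, i + 1 + b + 1), by rw [mem_sytCells]; omega, Prod.mk_lt_mk.2 ?_⟩
        omega

theorem syt_zero (a b : ℕ) : syt (a + 1) 0 b = (a + b).choose b := by
  induction a generalizing b with
  | zero => simp [syt_one_zero]
  | succ a ih =>
    induction b with
    | zero => rw [syt_zero_zero, ih]; simp
    | succ b ihb =>
      rw [syt_zero_succ, ih, ihb, show a + 1 + (b + 1) = (a + b + 1) + 1 by ring,
        Nat.choose_succ_succ', show a + 1 + b = a + b + 1 by ring, show a + (b + 1) = a + b + 1
        by ring, add_comm]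

/-- The right-hand side obeys the same removal recursion and boundary values as the count; here `n`
is the number of boxes. The auxiliary variables are tied by equations so that Pascal's rule applies
without truncated subtraction. -/
theorem syt_succ (a i b : ℕ) {n p s l : ℕ} (hn : n = a + b + 2 * i + 3)
    (hp : p = a + b + i + 1) (hs : s = b + i + 1) (hl : l = a + i) : (syt (a + 1) (i + 1) b : ℤ) =
    n.choose (i + 1) * p.choose s - n.choose (s + 1) * l.choose i := by
  have pascal : ∀ p q : ℕ, ((p + 1).choose (q + 1) : ℤ) = p.choose q + p.choose (q + 1) :=
    fun p q => by exact_mod_cast Nat.choose_succ_succ' p q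
  obtain ⟨k, hk⟩ : ∃ k, k = a + 2 * i + b := ⟨_, rfl⟩
  revert a i b n p s l
  induction k using Nat.strong_induction_on with | _ k ih =>
  intro a i b n p s l hn hp hs hl hk
  cases a with
  | zero =>
    -- The shape is not a Young diagram, and the two products cancel because (i + 1) + (s + 1) = n.
    rw [syt_one_succ]
    have h : n.choose (i + 1) = n.choose (s + 1) := Nat.choose_symm_of_eq_add (by omega)
    rw [h, show p = s by omega, show l = i by omega]
    simp
  | succ a =>
    obtain ⟨n, rfl⟩ : ∃ n', n = n' + 1 := ⟨n - 1, by omega⟩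
    obtain ⟨p, rfl⟩ : ∃ p', p = p' + 1 := ⟨p - 1, by omega⟩
    obtain ⟨l, rfl⟩ : ∃ l', l = l' + 1 := ⟨l - 1, by omega⟩
    obtain ⟨s, rfl⟩ : ∃ s', s = s' + 1 := ⟨s - 1, by omega⟩
    have ha := ih (a + 2 * i + b) (by omega) a i b (n := n) (p := p) (s := s + 1) (l := l) (by omega) (by omega) (by omega)
      (by omega) rfl
    -- Maximum in the last column of height 2. The factor C(l+1,i) - C(l,i) covers both cases: it
    -- vanishes for i = 0 and is C(l,i-1) otherwise.
    have hi : (syt (a + 2) i (b + 1) : ℤ) = n.choose i * (p + 1).choose (s + 1) -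
        n.choose (s + 2) * ((l + 1).choose i - l.choose i) := by
      cases i with
      | zero =>
        rw [syt_zero, show a + 1 + (b + 1) = p + 1 by omega, show b + 1 = s + 1 by omega]
        simp
      | succ i =>
        rw [ih (a + 1 + 2 * i + (b + 1)) (by omega) (a + 1) i (b + 1) (n := n) (p := p + 1) (s := s + 1) (l := l) (by omega)
          (by omega) (by omega) (by omega) rfl, pascal l i]
        ring
    -- Maximum at the end of the first row. Writing this count as a difference includes b = 0, where
    -- that corner is absent and the right-hand side is zero.
    have hb : ((syt (a + 2) (i + 1) b - syt (a + 1) (i + 1) b - syt (a + 2) i (b + 1) : ℤ)) =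
        n.choose (i + 1) * p.choose s - n.choose (s + 1) * (l + 1).choose i := by
      cases b with
      | zero =>
        rw [syt_succ_zero, show s = i by omega, show p = l + 1 by omega]
        push_cast
        ring
      | succ b =>
        rw [syt_succ_succ]
        push_cast
        rw [ih (a + 1 + 2 * i + b) (by omega) (a + 1) i b (n := n) (p := p) (s := s) (l := l + 1) (by omega)
          (by omega) (by omega) (by omega) rfl]
        ring
    have h1 := pascal n i
    have h2 := pascal p s
    have h3 := pascal n (s + 1)
    rw [h1, h3]
    linear_combination hb + ha + hi + (n.choose (i + 1) : ℤ) * (- h2)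

theorem syt_pos (a i b : ℕ) : 0 < syt (a + 2) i b := by
  induction i generalizing b with
  | zero => rw [syt_zero]; exact Nat.choose_pos (by omega)
  | succ i ih =>
    have := ih (b + 1)
    cases b with
    | zero => rw [syt_succ_zero]; simp only [zero_add] at this; omega
    | succ b => rw [syt_succ_succ]; simp only [add_assoc, Nat.reduceAdd] at this ⊢; omega

theorem sytBar_zero (a b : ℕ) : sytBar (a + 2) 0 b = syt (a + 1) 0 b := by
  have : SytBar (a + 2) 0 b = {T | T ∈ fillings (sytCells (a + 2) 0 b) (a + 1 + 2 * 0 + b + 1) ∧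
      ∃ c ∈ ({(a + 1, 0)} : Finset (ℕ × ℕ)), T c = a + 1 + 2 * 0 + b + 1} := by
    have hN : a + 1 + 2 * 0 + b + 1 = a + 2 + 2 * 0 + b := by ring
    rw [hN]
    ext T
    refine and_congr_right fun hT => ?_
    constructor
    · rintro ⟨r, c, hc, h1, h2, h3⟩
      refine ⟨(r, c), ?_, h3⟩
      rw [mem_sytCells] at h1 h2
      rw [Finset.mem_singleton, Prod.mk.injEq]
      omega
    · rintro ⟨c, hc, h⟩
      rw [Finset.mem_singleton] at hc
      subst hc
      exact ⟨a + 1, 0, Or.inl rfl, by rw [mem_sytCells]; omega, by rw [mem_sytCells]; omega, h⟩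
  rw [sytBar, this, ncard_fillings_max_mem (isLowerSet_sytCells (by omega)), Finset.sum_singleton,
    sytCells_erase_first, syt_eq_ncard_fillings]
  intro c hc
  rw [Finset.mem_singleton] at hc
  rw [hc, mem_sytCells]; omega

theorem sytBar_succ (a i b : ℕ) :
    sytBar (a + 2) (i + 1) b = syt (a + 1) (i + 1) b + syt (a + 2) i (b + 1) := by
  have : SytBar (a + 2) (i + 1) b =
      {T | T ∈ fillings (sytCells (a + 2) (i + 1) b) (a + 1 + 2 * (i + 1) + b + 1) ∧
      ∃ c ∈ ({(a + 1, 0), (1, i + 1)} : Finset (ℕ × ℕ)),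
        T c = a + 1 + 2 * (i + 1) + b + 1} := by
    have hN : a + 1 + 2 * (i + 1) + b + 1 = a + 2 + 2 * (i + 1) + b := by ring
    rw [hN]
    ext T
    refine and_congr_right fun hT => ?_
    constructor
    · rintro ⟨r, c, hc, h1, h2, h3⟩
      refine ⟨(r, c), ?_, h3⟩
      rw [mem_sytCells] at h1 h2
      rw [Finset.mem_insert, Finset.mem_singleton, Prod.mk.injEq, Prod.mk.injEq]
      omega
    · rintro ⟨c, hc, h⟩
      rw [Finset.mem_insert, Finset.mem_singleton] at hc
      rcases hc with rfl | rfl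
      · exact ⟨a + 1, 0, Or.inl rfl, by rw [mem_sytCells]; omega, by rw [mem_sytCells]; omega, h⟩
      · exact ⟨1, i + 1, Or.inr rfl, by rw [mem_sytCells]; omega, by rw [mem_sytCells]; omega, h⟩
  rw [sytBar, this, ncard_fillings_max_mem (isLowerSet_sytCells (by omega)),
    Finset.sum_pair (by simp), sytCells_erase_first, sytCells_erase_second, syt_eq_ncard_fillings,
    syt_eq_ncard_fillings, show a + 2 + 2 * i + (b + 1) = a + 1 + 2 * (i + 1) + b by ring]
  intro c hc
  rw [Finset.mem_insert, Finset.mem_singleton] at hc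
  rcases hc with rfl | rfl <;> rw [mem_sytCells] <;> omega

/-- This is the case h = k - 1, in which relaxation does nothing. For i = 0 and b > 0 the single row
has its maximum at the right end, away from the first column. The excluded shape is a single box,
where the count is not zero. -/
theorem sytBar_one {i b : ℕ} (h : i ≠ 0 ∨ b ≠ 0) : sytBar 1 i b = 0 := by
  rw [sytBar, Set.ncard_eq_zero ((finite_fillings (sytCells 1 i b) _).subset fun T hT => hT.1)]
  rw [Set.eq_empty_iff_forall_notMem]
  rintro T ⟨hT, r, c, hc, h1, h2, h3⟩
  cases i with
  | succ i =>
    have hlow := hT.1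
    have h4 : ((1, 1) : ℕ × ℕ) ∈ (sytCells 1 (i + 1) b : Set (ℕ × ℕ)) := by
      rw [Finset.mem_coe, mem_sytCells]; omega
    have := hlow (Prod.mk_le_mk.2 ⟨le_rfl, zero_le_one⟩ : ((1, 0) : ℕ × ℕ) ≤ (1, 1)) h4
    rw [Finset.mem_coe, mem_sytCells] at this
    omega
  | zero =>
    rw [mem_sytCells] at h1
    have h4 : (0, 1) ∈ sytCells 1 0 b := by rw [mem_sytCells]; omega
    have h5 := lt_of_mem_fillings hT h4 (Prod.mk_lt_mk.2 (by omega) : (r, c) < (0, 1))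
    have h6 := (hT.2.2.1.mapsTo h4).2
    omega

theorem sytBar_pos (a i b : ℕ) : 0 < sytBar (a + 2) i b := by
  cases i with
  | zero => rw [sytBar_zero, syt_zero]; exact Nat.choose_pos (by omega)
  | succ i => rw [sytBar_succ]; have := syt_pos a i (b + 1); omega

end Shapes

/-! ### Natural-number rank functions and flats -/

section Rank

variable {α : Type u} [Finite α]

theorem coe_rk (M : Matroid α) (X : Set α) : (rk M X : ℕ∞) = M.eRk X := by
  rw [rk, ENat.natCast_toNat]
  exact ne_top_of_le_ne_top (Set.encard_ne_top_iff.2 (Set.toFinite X)) (M.eRk_le_encard X)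

theorem rk_le_ncard (M : Matroid α) (X : Set α) : rk M X ≤ X.ncard := by
  rw [← Nat.cast_le (α := ℕ∞), coe_rk, (Set.toFinite X).cast_ncard_eq]
  exact M.eRk_le_encard X

theorem rk_mono (M : Matroid α) {X Y : Set α} (h : X ⊆ Y) : rk M X ≤ rk M Y := by
  rw [← Nat.cast_le (α := ℕ∞), coe_rk, coe_rk]
  exact M.eRk_mono h

theorem rk_le_rank (M : Matroid α) (X : Set α) : rk M X ≤ rank M := by
  rw [rank, ← Nat.cast_le (α := ℕ∞), coe_rk, coe_rk, M.eRk_ground]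
  exact M.eRk_le_eRank X

theorem rk_empty (M : Matroid α) : rk M ∅ = 0 := by
  rw [rk, M.eRk_empty]; rfl

theorem rk_closure (M : Matroid α) (X : Set α) : rk M (M.closure X) = rk M X := by
  rw [rk, M.eRk_closure_eq, rk]

theorem rk_restrict (M : Matroid α) {R X : Set α} (h : X ⊆ R) : rk (M.restrict R) X = rk M X := by
  rw [rk, M.restrict_eRk_eq h, rk]

theorem rank_restrict (M : Matroid α) (R : Set α) : rank (M.restrict R) = rk M R :=
  rk_restrict M subset_rfl

theorem indep_iff_rk (M : Matroid α) {I : Set α} : M.Indep I ↔ rk M I = I.ncard := by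
  rw [Matroid.indep_iff_eRk_eq_encard_of_finite (Set.toFinite I), ← coe_rk,
    ← (Set.toFinite I).cast_ncard_eq, Nat.cast_inj]

/-- A basis of `C` extends to a basis of `X ∪ C`, and the added elements form a basis in the
contraction. -/
theorem rk_contract_add (M : Matroid α) (C X : Set α) :
    rk (M.contract C) X + rk M C = rk M (X ∪ C) := by
  obtain ⟨J, hJ⟩ := M.exists_isBasis' C
  obtain ⟨I, hI, hJI⟩ := hJ.indep.subset_isBasis'_of_subset
    (hJ.subset.trans (Set.subset_union_right : C ⊆ X ∪ C))
  have hIC : I ∩ C = J := (hJ.eq_of_subset_indep (hI.indep.subset Set.inter_subset_left)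
    (Set.subset_inter hJI hJ.subset) Set.inter_subset_right).symm
  have hun : I \ C ∪ J = I := by rw [← hIC]; exact Set.sdiff_union_inter I C
  have h := hI.contract_isBasis' hJ (by rw [hun]; exact hI.indep)
  have h1 : rk (M.contract C) X = (I \ C).ncard := by
    have h2 : (M.contract C).eRk X = (M.contract C).eRk ((X ∪ C) \ C) := by
      rw [← (M.contract C).eRk_inter_ground X, ← (M.contract C).eRk_inter_ground ((X ∪ C) \ C)]
      congr 1
      ext e
      simp only [Matroid.contract_ground, Set.mem_inter_iff, Set.mem_sdiff, Set.mem_union]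
      tauto
    rw [rk, h2, h.eRk_eq_encard, Set.ncard_def]
  rw [h1, rk, hJ.eRk_eq_encard, rk, hI.eRk_eq_encard, ← Set.ncard_def, ← Set.ncard_def, ← hIC,
    add_comm]
  exact Set.ncard_inter_add_ncard_sdiff_eq_ncard I C (Set.toFinite _)

theorem rank_contract_add (M : Matroid α) {C : Set α} (hC : C ⊆ M.E) :
    rank (M.contract C) + rk M C = rank M := by
  rw [rank, rk_contract_add, Matroid.contract_ground, Set.sdiff_union_of_subset hC, rank]

/-- Flatness is expressed by ranks because the rank function is what is known explicitly for uniform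
and relaxed matroids. -/
theorem isFlat_iff_rk (M : Matroid α) {F : Set α} :
    M.IsFlat F ↔ F ⊆ M.E ∧ ∀ e ∈ M.E \ F, rk M (insert e F) = rk M F + 1 := by
  constructor
  · intro hF
    refine ⟨hF.subset_ground, fun e he => ?_⟩
    rw [← Nat.cast_inj (R := ℕ∞), Nat.cast_add, coe_rk, coe_rk]
    exact M.eRk_insert_eq_add_one (by rwa [hF.closure])
  · rintro ⟨hFE, h⟩
    rw [Matroid.isFlat_iff_closure_eq]
    refine (M.subset_closure F hFE).antisymm' fun e he => ?_
    by_contra heF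
    have h1 := h e ⟨M.closure_subset_ground F he, heF⟩
    have h2 := rk_mono M (Set.insert_subset he (M.subset_closure F hFE))
    rw [rk_closure] at h2
    omega

theorem isFlat_restrict_iff (M : Matroid α) {F G : Set α} (hF : M.IsFlat F) :
    (M.restrict F).IsFlat G ↔ M.IsFlat G ∧ G ⊆ F := by
  constructor
  · intro hG
    have hGF : G ⊆ F := hG.subset_ground
    refine ⟨?_, hGF⟩
    have := hG.closure
    rw [M.restrict_closure_eq hGF hF.subset_ground, Set.inter_eq_left.2] at this
    · rw [Matroid.isFlat_iff_closure_eq, this]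
    · have := M.closure_subset_closure hGF
      rwa [hF.closure] at this
  · rintro ⟨hG, hGF⟩
    rw [Matroid.isFlat_iff_closure_eq, M.restrict_closure_eq hGF hF.subset_ground, hG.closure,
      Set.inter_eq_left.2 hGF]

theorem rk_eq_rank_iff_of_isFlat (M : Matroid α) {F : Set α} (hF : M.IsFlat F) :
    rk M F = rank M ↔ F = M.E := by
  refine ⟨fun h => ?_, fun h => by rw [h, rank]⟩
  by_contra hne
  obtain ⟨e, he, heF⟩ := Set.exists_of_ssubset (hF.subset_ground.ssubset_of_ne hne)
  have h1 := ((isFlat_iff_rk M).1 hF).2 e ⟨he, heF⟩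
  have h2 := rk_le_rank M (insert e F)
  omega

theorem eq_of_rk_eq {M N : Matroid α} (hE : M.E = N.E) (h : ∀ X ⊆ M.E, rk M X = rk N X) :
    M = N := by
  refine Matroid.ext_indep hE fun I hI => ?_
  rw [indep_iff_rk, indep_iff_rk, h I hI]

theorem closure_subset_iff (M : Matroid α) {F X : Set α} (hF : M.IsFlat F) (hX : X ⊆ M.E) :
    M.closure X ⊆ F ↔ X ⊆ F :=
  ⟨(M.subset_closure X hX).trans, fun h => by
    simpa [hF.closure] using M.closure_subset_closure h⟩

end Rank

/-! ### Characteristic polynomials as sums over subsets -/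

section Subsets

open scoped Classical

variable {α : Type u} [Fintype α]

/-- The finite sets between `F` and `G`. -/
def between (F G : Set α) : Finset (Finset α) :=
  Finset.univ.filter fun A => F ⊆ A ∧ (A : Set α) ⊆ G

theorem mem_between {F G : Set α} {A : Finset α} :
    A ∈ between F G ↔ F ⊆ A ∧ (A : Set α) ⊆ G := by
  simp [between]

/-- The sign in inclusion-exclusion over the sets containing `F`. -/
def relSign (F : Set α) (A : Finset α) : ℤ := (-1) ^ (A.card + F.ncard)

theorem sum_between_relSign {F G : Set α} (h : F ⊆ G) :
    ∑ A ∈ between F G, relSign F A = if F = G then 1 else 0 := by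
  have h1 : ∑ A ∈ between F G, relSign F A =
      ∑ B ∈ (G \ F).toFinset.powerset, (-1 : ℤ) ^ B.card := by
    refine Finset.sum_bij' (fun A _ => A \ F.toFinset) (fun B _ => B ∪ F.toFinset) ?_ ?_ ?_ ?_ ?_
    · intro A hA
      rw [mem_between] at hA
      rw [Finset.mem_powerset]
      intro e he
      simp only [Finset.mem_sdiff, Set.mem_toFinset, Set.mem_sdiff] at he ⊢
      exact ⟨hA.2 he.1, he.2⟩
    · intro B hB
      rw [Finset.mem_powerset] at hB
      rw [mem_between]
      refine ⟨by simp, ?_⟩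
      rw [Finset.coe_union, Set.coe_toFinset]
      refine Set.union_subset (fun e he => ?_) h
      have := hB he
      rw [Set.mem_toFinset] at this
      exact this.1
    · intro A hA
      rw [mem_between] at hA
      exact Finset.sdiff_union_of_subset (by simpa [← Finset.coe_subset] using hA.1)
    · intro B hB
      rw [Finset.mem_powerset] at hB
      refine Finset.union_sdiff_cancel_right (Finset.disjoint_left.2 fun e he => ?_)
      have := hB he
      rw [Set.mem_toFinset] at this
      rw [Set.mem_toFinset]
      exact this.2
    · intro A hA
      rw [mem_between] at hA
      have hsub : F.toFinset ⊆ A := by simpa [← Finset.coe_subset] using hA.1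
      have := Finset.card_sdiff_add_card_eq_card hsub
      rw [relSign, ← this, Set.ncard_eq_toFinset_card', add_assoc, pow_add, ← two_mul, pow_mul]
      simp
  rw [h1, Finset.sum_powerset_neg_one_pow_card]
  congr 1
  rw [Set.toFinset_eq_empty, Set.sdiff_eq_empty]
  exact propext ⟨fun h' => h.antisymm h', fun h' => h' ▸ subset_rfl⟩

variable (M : Matroid α)

/-- The characteristic polynomial of the interval between two flats, as a sum over sets. -/
def chi (F G : Set α) : ℤ[X] :=
  ∑ A ∈ between F G, C (relSign F A) * X ^ (rk M G - rk M A)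

/-- The reversed characteristic polynomial of the interval between two flats. -/
def chiRev (F G : Set α) : ℤ[X] :=
  ∑ A ∈ between F G, C (relSign F A) * X ^ (rk M A - rk M F)

instance : Fintype (Flats M) := Fintype.ofFinite _

theorem reflect_chi (F G : Set α) :
    reflect (rk M G - rk M F) (chi M F G) = chiRev M F G := by
  ext i
  rw [chi, chiRev, coeff_reflect, finsetSum_coeff, finsetSum_coeff]
  refine Finset.sum_congr rfl fun A hA => ?_
  rw [mem_between] at hA
  have h1 := rk_mono M hA.1
  have h2 := rk_mono M hA.2
  rw [← coeff_reflect, reflect_C_mul_X_pow, revAt_le (by omega)]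
  congr 3
  omega

theorem natDegree_chiRev_le (F G : Set α) : (chiRev M F G).natDegree ≤ rk M G - rk M F := by
  refine natDegree_sum_le_of_forall_le _ _ fun A hA => ?_
  rw [mem_between] at hA
  refine (natDegree_C_mul_X_pow_le _ _).trans ?_
  have := rk_mono M hA.2
  omega

theorem reflect_chiRev (F G : Set α) :
    reflect (rk M G - rk M F) (chiRev M F G) = chi M F G := by
  ext i
  rw [← reflect_chi, coeff_reflect, coeff_reflect, revAt_invol]

theorem chiRev_self (F : Set α) : chiRev M F F = 1 := by
  have : between F F = {F.toFinset} := by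
    ext A
    rw [mem_between, Finset.mem_singleton, ← Finset.coe_inj, Set.coe_toFinset]
    exact ⟨fun h => h.2.antisymm h.1, fun h => by rw [h]; exact ⟨subset_rfl, subset_rfl⟩⟩
  rw [chiRev, this, Finset.sum_singleton, relSign, Set.ncard_eq_toFinset_card', ← two_mul, pow_mul]
  simp

theorem chiRev_congr {M N : Matroid α} {F G : Set α} (h : ∀ X ⊆ G, rk M X = rk N X)
    (hFG : F ⊆ G) : chiRev M F G = chiRev N F G := by
  rw [chiRev, chiRev]
  refine Finset.sum_congr rfl fun A hA => ?_
  rw [mem_between] at hA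
  rw [h _ hA.2, h _ hFG]

/-- The Möbius function of the lattice of flats, as a sum over spanning sets. -/
theorem moebius_eq (F G : Flats M) (hFG : F ≤ G) : moebius M F G =
    ∑ A ∈ (between F.1 M.E).filter (fun A : Finset α => M.closure A = G.1), relSign F.1 A := by
  have hmu : ∀ H : Flats M, F ≤ H →
      ∑ K ∈ Finset.univ.filter (fun K => F ≤ K ∧ K ≤ H), moebius M F K =
        if F = H then 1 else 0 := by
    intro H _
    let _ : LocallyFiniteOrder (Flats M) := Fintype.toLocallyFiniteOrder
    refine Eq.trans (Finset.sum_congr ?_ fun K _ => rfl) (IncidenceAlgebra.sum_Icc_mu_right F H)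
    ext K
    simp
  -- The signed sums over sets with prescribed closure satisfy the defining recursion of the Möbius
  -- function: a set lies in the flat `H` exactly if its closure does, so the sum over the interval
  -- is plain inclusion-exclusion.
  have hnu : ∀ H : Flats M, F ≤ H →
      ∑ K ∈ Finset.univ.filter (fun K => F ≤ K ∧ K ≤ H),
        ∑ A ∈ (between F.1 M.E).filter (fun A : Finset α => M.closure A = K.1), relSign F.1 A =
        if F = H then 1 else 0 := by
    intro H hFH
    have h1 := sum_between_relSign (show F.1 ⊆ H.1 from hFH)
    rw [← Finset.sum_fiberwise_of_maps_to (s := between F.1 H.1)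
      (t := Finset.univ.filter (fun K : Flats M => F ≤ K ∧ K ≤ H))
      (g := fun A : Finset α => (⟨M.closure A, M.isFlat_closure A⟩ : Flats M))] at h1
    · simp only [Subtype.ext_iff] at h1 ⊢
      rw [← h1]
      refine Finset.sum_congr rfl fun K hK => Finset.sum_congr ?_ fun _ _ => rfl
      rw [Finset.mem_filter] at hK
      ext A
      rw [Finset.mem_filter, Finset.mem_filter, mem_between, mem_between]
      refine and_congr_left fun hA => and_congr_right fun _ => ?_
      refine ⟨fun h => ?_, fun h => h.trans H.2.subset_ground⟩
      exact ((M.subset_closure _ h).trans (hA.le)).trans hK.2.2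
    · intro A hA
      rw [mem_between] at hA
      have hAE := hA.2.trans H.2.subset_ground
      simp only [Finset.mem_filter, Finset.mem_univ, true_and]
      exact ⟨hA.1.trans (M.subset_closure _ hAE), (closure_subset_iff M H.2 hAE).2 hA.2⟩
  induction G using WellFoundedLT.induction with | _ G ih =>
  have hsplit : Finset.univ.filter (fun K => F ≤ K ∧ K ≤ G) =
      insert G (Finset.univ.filter (fun K => F ≤ K ∧ K < G)) := by
    ext K
    simp only [Finset.mem_filter, Finset.mem_univ, true_and, Finset.mem_insert]
    constructor
    · rintro ⟨h1, h2⟩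
      exact h2.eq_or_lt.imp id fun h => ⟨h1, h⟩
    · rintro (rfl | ⟨h1, h2⟩)
      · exact ⟨hFG, le_rfl⟩
      · exact ⟨h1, h2.le⟩
  have h1 := hmu G hFG
  rw [← hnu G hFG, hsplit, Finset.sum_insert (by simp), Finset.sum_insert (by simp)] at h1
  rw [Finset.sum_congr rfl (g := fun K : Flats M =>
    ∑ A ∈ (between F.1 M.E).filter (fun A : Finset α => M.closure A = K.1), relSign F.1 A)] at h1
  · exact add_right_cancel h1
  · intro K hK
    rw [Finset.mem_filter] at hK
    exact ih K hK.2.2 hK.2.1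

/-- Sets with the same closure have the same rank, and their signs add up to a Möbius value. -/
theorem chi_eq_sum_moebius (F : Flats M) : chi M F.1 M.E =
    ∑ G ∈ Finset.univ.filter (fun G => F ≤ G), C (moebius M F G) * X ^ (rank M - rk M G.1) := by
  rw [chi, ← Finset.sum_fiberwise_of_maps_to
      (t := Finset.univ.filter (fun G : Flats M => F ≤ G))
      (g := fun A : Finset α => (⟨M.closure A, M.isFlat_closure A⟩ : Flats M))]
  · refine Finset.sum_congr rfl fun G hG => ?_
    rw [Finset.mem_filter] at hG
    rw [moebius_eq M F G hG.2, map_sum, Finset.sum_mul]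
    refine Finset.sum_congr ?_ fun A hA => ?_
    · simp only [Subtype.ext_iff]
    · rw [Finset.mem_filter] at hA
      rw [← hA.2, rk_closure, rank]
  · intro A hA
    rw [mem_between] at hA
    simp only [Finset.mem_filter, Finset.mem_univ, true_and]
    exact hA.1.trans (M.subset_closure _ hA.2)

/-- Looplessness makes `∅` the bottom flat. It cannot be dropped: a loop would make the signed sum
over subsets vanish, but it is invisible to the lattice of flats. -/
theorem charPoly_eq_chi (h : M.closure ∅ = ∅) : charPoly M = chi M ∅ M.E := by
  have := chi_eq_sum_moebius M (botFlat M)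
  rw [show (botFlat M).1 = ∅ from h] at this
  rw [this, charPoly, finsum_eq_sum_of_fintype]
  refine Finset.sum_congr ?_ fun _ _ => rfl
  ext G
  simp only [Finset.mem_filter, Finset.mem_univ, true_and, true_iff]
  exact fun e he => by simp [show (botFlat M).1 = ∅ from h] at he

theorem charPoly_contract {F : Set α} (hF : M.IsFlat F) :
    charPoly (M.contract F) = chi M F M.E := by
  rw [charPoly_eq_chi]
  · rw [chi, chi]
    have hdisj : ∀ A ∈ between ∅ (M.contract F).E, Disjoint A F.toFinset := by
      intro A hA
      rw [mem_between, Matroid.contract_ground] at hA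
      refine Finset.disjoint_left.2 fun e he => ?_
      rw [Set.mem_toFinset]
      exact (hA.2 he).2
    refine Finset.sum_bij' (fun A _ => A ∪ F.toFinset) (fun A _ => A \ F.toFinset) ?_ ?_ ?_ ?_ ?_
    · intro A hA
      rw [mem_between, Matroid.contract_ground] at hA
      rw [mem_between, Finset.coe_union, Set.coe_toFinset]
      exact ⟨Set.subset_union_right,
        Set.union_subset (hA.2.trans Set.sdiff_subset) hF.subset_ground⟩
    · intro A hA
      rw [mem_between] at hA
      rw [mem_between, Matroid.contract_ground, Finset.coe_sdiff, Set.coe_toFinset]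
      exact ⟨Set.empty_subset _, Set.sdiff_subset_sdiff_left hA.2⟩
    · intro A hA
      exact Finset.union_sdiff_cancel_right (hdisj A hA)
    · intro A hA
      rw [mem_between] at hA
      exact Finset.sdiff_union_of_subset (by simpa [← Finset.coe_subset] using hA.1)
    · intro A hA
      have h1 := rk_contract_add M F A
      have h2 := rank_contract_add M hF.subset_ground
      rw [relSign, relSign, Finset.card_union_of_disjoint (hdisj A hA), Finset.coe_union,
        Set.coe_toFinset, Set.ncard_eq_toFinset_card' F, Set.ncard_empty, add_assoc, ← two_mul,
        pow_add, pow_add, pow_mul]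
      rw [← rank, ← rank]
      simp only [pow_zero, mul_one, even_two, Even.neg_pow, one_pow]
      congr 2
      omega
  · have := M.contract_loops_eq F
    rw [hF.closure, Set.sdiff_self] at this
    exact this

/-- Möbius inversion: the characteristic polynomials of the contractions sum to a power of `t`. -/
theorem sum_chi (K : Flats M) :
    ∑ F ∈ Finset.univ.filter (fun F => K ≤ F), chi M F.1 M.E = X ^ (rank M - rk M K.1) := by
  have hmu : ∀ H : Flats M,
      ∑ F ∈ Finset.univ.filter (fun F => K ≤ F ∧ F ≤ H), moebius M F H =
        if K = H then 1 else 0 := by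
    intro H
    let _ : LocallyFiniteOrder (Flats M) := Fintype.toLocallyFiniteOrder
    refine Eq.trans (Finset.sum_congr ?_ fun F _ => rfl) (IncidenceAlgebra.sum_Icc_mu_left K H)
    ext F
    simp
  calc ∑ F ∈ Finset.univ.filter (fun F => K ≤ F), chi M F.1 M.E
      = ∑ F ∈ Finset.univ.filter (fun F => K ≤ F), ∑ H ∈ Finset.univ.filter (fun H => F ≤ H),
          C (moebius M F H) * X ^ (rank M - rk M H.1) :=
        Finset.sum_congr rfl fun F _ => chi_eq_sum_moebius M F
    _ = ∑ H : Flats M, ∑ F ∈ Finset.univ.filter (fun F => K ≤ F ∧ F ≤ H),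
          C (moebius M F H) * X ^ (rank M - rk M H.1) :=
        Finset.sum_comm' (by simp)
    _ = ∑ H : Flats M, C (if K = H then 1 else 0) * X ^ (rank M - rk M H.1) := by
        refine Finset.sum_congr rfl fun H _ => ?_
        rw [← Finset.sum_mul, ← map_sum, hmu]
    _ = X ^ (rank M - rk M K.1) := by
        rw [Finset.sum_eq_single K]
        · simp
        · intro H _ hH
          simp [hH.symm]
        · simp

/-- The characteristic polynomials form a kernel of the lattice of flats. -/
theorem sum_chiRev_mul_chi (G : Flats M) (hG : G.1 ≠ M.E) :
    ∑ F ∈ Finset.univ.filter (fun F => G ≤ F), chiRev M G.1 F.1 * chi M F.1 M.E = 0 := by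
  have hGE := G.2.subset_ground
  calc ∑ F ∈ Finset.univ.filter (fun F => G ≤ F), chiRev M G.1 F.1 * chi M F.1 M.E
      = ∑ F ∈ Finset.univ.filter (fun F => G ≤ F), ∑ A ∈ between G.1 F.1,
          C (relSign G.1 A) * X ^ (rk M A - rk M G.1) * chi M F.1 M.E :=
        Finset.sum_congr rfl fun F _ => by rw [chiRev, Finset.sum_mul]
    -- After the exchange, `F` runs over the flats above the closure of `A`, so `sum_chi` collapses
    -- the inner sum to a power of t. The total exponent no longer depends on `A`, and the signs
    -- cancel.
    _ = ∑ A ∈ between G.1 M.E, ∑ F ∈ Finset.univ.filter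
          (fun F : Flats M => (⟨M.closure A, M.isFlat_closure A⟩ : Flats M) ≤ F),
          C (relSign G.1 A) * X ^ (rk M A - rk M G.1) * chi M F.1 M.E := by
        refine Finset.sum_comm' fun F A => ?_
        simp only [Finset.mem_filter, Finset.mem_univ, true_and, mem_between]
        constructor
        · rintro ⟨-, h2, h3⟩
          have hA := h3.trans F.2.subset_ground
          exact ⟨(closure_subset_iff M F.2 hA).2 h3, h2, hA⟩
        · rintro ⟨h1, h2, h3⟩
          have := (closure_subset_iff M F.2 h3).1 h1
          exact ⟨h2.trans this, h2, this⟩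
    _ = ∑ A ∈ between G.1 M.E, C (relSign G.1 A) * X ^ (rank M - rk M G.1) := by
        refine Finset.sum_congr rfl fun A hA => ?_
        rw [mem_between] at hA
        rw [← Finset.mul_sum, sum_chi, rk_closure, mul_assoc, ← pow_add]
        have h1 := rk_mono M hA.1
        have h2 := rk_le_rank M A
        congr 2
        omega
    _ = 0 := by
        rw [← Finset.sum_mul, ← map_sum, sum_between_relSign hGE, if_neg hG]
        simp

end Subsets

/-! ### Existence of the inverse Kazhdan–Lusztig polynomials and their coefficients -/

section Existence

open scoped Classical

variable {α : Type u} [Fintype α]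

/-- The part of a polynomial in degrees less than `r / 2`. -/
def lowerHalf (r : ℕ) (p : ℤ[X]) : ℤ[X] :=
  ∑ i ∈ Finset.range ((r + 1) / 2), C (p.coeff i) * X ^ i

theorem coeff_lowerHalf (r : ℕ) (p : ℤ[X]) (i : ℕ) :
    (lowerHalf r p).coeff i = if 2 * i < r then p.coeff i else 0 := by
  rw [lowerHalf, finsetSum_coeff]
  simp only [coeff_C_mul, coeff_X_pow, mul_ite, mul_one, mul_zero, Finset.sum_ite_eq,
    Finset.mem_range]
  congr 1
  exact propext ⟨fun h => by omega, fun h => by omega⟩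

theorem natDegree_lowerHalf_lt {r : ℕ} (hr : 0 < r) (p : ℤ[X]) :
    2 * (lowerHalf r p).natDegree < r := by
  by_contra hcon
  have h0 : lowerHalf r p = 0 := by
    rw [← leadingCoeff_eq_zero, leadingCoeff, coeff_lowerHalf, if_neg hcon]
  rw [h0, natDegree_zero] at hcon
  omega

/-- An antipalindromic polynomial is determined by its coefficients below degree r/2. -/
theorem lowerHalf_sub_reflect {r : ℕ} {p : ℤ[X]} (hp : reflect r p = -p) :
    lowerHalf r p - reflect r (lowerHalf r p) = p := by
  ext i
  have h := congrArg (fun q => q.coeff i) hp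
  simp only [coeff_reflect, coeff_neg] at h
  rw [coeff_sub, coeff_reflect, coeff_lowerHalf, coeff_lowerHalf]
  by_cases hi : i ≤ r
  · rw [revAt_le hi] at h ⊢
    split_ifs with h1 h2 h2
    · omega
    · ring
    · rw [h]; ring
    -- The middle coefficient equals its own negative.
    · have : r - i = i := by omega
      rw [this] at h
      omega
  -- Beyond degree `r` the reflection fixes every coefficient, so these too are their own negatives.
  · rw [revAt_eq_self_of_lt (by omega)] at h ⊢
    split_ifs with h1
    · omega
    · omega

/-- The inverse Kazhdan–Lusztig polynomial, constructed by recursion on the ground set. -/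
def recKL (M : Matroid α) : ℤ[X] :=
  if rank M = 0 then if M.E = ∅ then 1 else 0
  else (-1) ^ (rank M + 1) *
    -- Proper flats are singled out by cardinality, which is the measure that shows termination.
    lowerHalf (rank M) (∑ F : Flats M, if _h : F.1.ncard < M.E.ncard then
      (-1) ^ rk M F.1 * recKL (M.restrict F.1) * chiRev M F.1 M.E else 0)
termination_by M.E.ncard
decreasing_by exact _h

/-- The terms of the recursion that belong to proper flats. -/
def properSum (Q : Matroid α → ℤ[X]) (M : Matroid α) : ℤ[X] :=
  ∑ F ∈ Finset.univ.filter (fun F : Flats M => F.1 ≠ M.E),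
    (-1) ^ rk M F.1 * Q (M.restrict F.1) * chiRev M F.1 M.E

theorem recKL_of_pos {M : Matroid α} (h : 0 < rank M) :
    recKL M = (-1) ^ (rank M + 1) * lowerHalf (rank M) (properSum recKL M) := by
  rw [recKL, if_neg h.ne', properSum, Finset.sum_filter]
  congr 2
  refine Finset.sum_congr rfl fun F _ => ?_
  by_cases hF : F.1 = M.E
  · simp [hF]
  · simp [hF, Set.ncard_lt_ncard (F.2.subset_ground.ssubset_of_ne hF) (Set.toFinite _)]

theorem recursion_sum_eq (Q : Matroid α → ℤ[X]) (M : Matroid α) :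
    ∑ᶠ F : Flats M, (-1) ^ rk M F.1 * Q (M.restrict F.1) *
        reflect (rank M - rk M F.1) (charPoly (M.contract F.1)) =
      (-1) ^ rank M * Q M + properSum Q M := by
  rw [finsum_eq_sum_of_fintype, properSum]
  have h : ∀ F : Flats M, (-1) ^ rk M F.1 * Q (M.restrict F.1) *
        reflect (rank M - rk M F.1) (charPoly (M.contract F.1)) =
      (-1) ^ rk M F.1 * Q (M.restrict F.1) * chiRev M F.1 M.E := by
    intro F
    rw [charPoly_contract M F.2, rank, reflect_chi]
  simp only [h]
  rw [← Finset.sum_filter_add_sum_filter_not Finset.univ (fun F : Flats M => F.1 = M.E)]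
  congr 1
  have : Finset.univ.filter (fun F : Flats M => F.1 = M.E) = {⟨M.E, M.ground_isFlat⟩} := by
    ext F
    simp [Subtype.ext_iff]
  rw [this, Finset.sum_singleton, chiRev_self, Matroid.restrict_ground_eq_self, mul_one, rank]

/-- The recursion at one matroid. -/
def Recursion (Q : Matroid α → ℤ[X]) (M : Matroid α) : Prop :=
  (-1) ^ rank M * reflect (rank M) (Q M) = (-1) ^ rank M * Q M + properSum Q M

theorem natDegree_recKL_le (M : Matroid α) : (recKL M).natDegree ≤ rank M := by
  rcases (rank M).eq_zero_or_pos with h | h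
  · rw [recKL, if_pos h]
    split_ifs <;> simp
  · rw [recKL_of_pos h]
    have h1 := natDegree_lowerHalf_lt h (properSum recKL M)
    have h2 : (((-1) ^ (rank M + 1) : ℤ[X])) = C ((-1) ^ (rank M + 1)) := by simp
    rw [h2]
    exact (natDegree_C_mul_le _ _).trans (by omega)

theorem neg_one_pow_mul_reflect (n r : ℕ) (p : ℤ[X]) :
    reflect r ((-1) ^ n * p) = (-1) ^ n * reflect r p := by
  have h2 : (((-1) ^ n : ℤ[X])) = C ((-1) ^ n) := by simp
  rw [h2, reflect_C_mul]

theorem sum_flats_restrict (M : Matroid α) (F : Flats M) (f : Set α → ℤ[X]) :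
    ∑ G : Flats (M.restrict F.1), f G.1 =
      ∑ G ∈ Finset.univ.filter (fun G : Flats M => G ≤ F), f G.1 := by
  refine Finset.sum_bij' (fun G _ => ⟨G.1, ((isFlat_restrict_iff M F.2).1 G.2).1⟩)
    (fun G hG => ⟨G.1, (isFlat_restrict_iff M F.2).2 ⟨G.2, (Finset.mem_filter.1 hG).2⟩⟩)
    ?_ ?_ ?_ ?_ ?_
  · intro G _
    simp only [Finset.mem_filter, Finset.mem_univ, true_and]
    exact ((isFlat_restrict_iff M F.2).1 G.2).2
  · simp
  · simp
  · simp
  · simp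

/-- Flats of a restriction to `F` are the flats below `F`, and ranks inside `F` do not change. The
recursion for the restriction can therefore be read inside `M`. -/
theorem Recursion.restrict {Q : Matroid α → ℤ[X]} {M : Matroid α} {F : Flats M}
    (h : Recursion Q (M.restrict F.1)) :
    (-1) ^ rk M F.1 * reflect (rk M F.1) (Q (M.restrict F.1)) =
      ∑ G ∈ Finset.univ.filter (fun G : Flats M => G ≤ F),
        (-1) ^ rk M G.1 * Q (M.restrict G.1) * chiRev M G.1 F.1 := by
  rw [Recursion, ← recursion_sum_eq, rank_restrict, finsum_eq_sum_of_fintype] at h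
  rw [h, ← sum_flats_restrict M F
    (fun G => (-1) ^ rk M G * Q (M.restrict G) * chiRev M G F.1)]
  refine Finset.sum_congr rfl fun G _ => ?_
  have hGF : G.1 ⊆ F.1 := G.2.subset_ground
  rw [rk_restrict M hGF, Matroid.restrict_restrict_eq _ hGF, charPoly_contract _ G.2,
    ← chiRev_congr (M := M.restrict F.1) (fun X hX => rk_restrict M hX) hGF, ← reflect_chi,
    rk_restrict M hGF, rk_restrict M subset_rfl]
  rfl

/-- Reflection acts on both factors of each term. The recursion for the smaller matroids expands the
reflected polynomials; after an exchange of summation, the kernel identity evaluates the sum over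
the proper flats above `G` as minus its term at the ground set. -/
theorem reflect_properSum {M : Matroid α}
    (h : ∀ F : Flats M, F.1 ≠ M.E → Recursion recKL (M.restrict F.1)) :
    reflect (rank M) (properSum recKL M) = -properSum recKL M := by
  have hlin : ∀ (s : Finset (Flats M)) (f : Flats M → ℤ[X]),
      reflect (rank M) (∑ F ∈ s, f F) = ∑ F ∈ s, reflect (rank M) (f F) := by
    intro s f
    ext i
    simp only [coeff_reflect, finsetSum_coeff]
  calc reflect (rank M) (properSum recKL M)
      = ∑ F ∈ Finset.univ.filter (fun F : Flats M => F.1 ≠ M.E),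
          ∑ G ∈ Finset.univ.filter (fun G : Flats M => G ≤ F),
            (-1) ^ rk M G.1 * recKL (M.restrict G.1) * chiRev M G.1 F.1 * chi M F.1 M.E := by
        rw [properSum, hlin]
        refine Finset.sum_congr rfl fun F hF => ?_
        rw [Finset.mem_filter] at hF
        rw [← Finset.sum_mul, ← (h F hF.2).restrict, mul_assoc, neg_one_pow_mul_reflect,
          mul_assoc, ← reflect_chiRev]
        congr 1
        -- The reflection of order rk M splits along rk F and rk M - rk F, which bound the degrees
        -- of the two factors.
        have hle := rk_le_rank M F.1
        conv_lhs => rw [show rank M = rk M F.1 + (rank M - rk M F.1) by omega]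
        exact reflect_mul _ _ ((natDegree_recKL_le _).trans (rank_restrict M _).le)
          (natDegree_chiRev_le M _ _)
    _ = ∑ G ∈ Finset.univ.filter (fun G : Flats M => G.1 ≠ M.E),
          ∑ F ∈ Finset.univ.filter (fun F : Flats M => G ≤ F ∧ F.1 ≠ M.E),
            (-1) ^ rk M G.1 * recKL (M.restrict G.1) * chiRev M G.1 F.1 * chi M F.1 M.E := by
        refine Finset.sum_comm' fun F G => ?_
        simp only [Finset.mem_filter, Finset.mem_univ, true_and]
        refine ⟨fun h => ⟨⟨h.2, h.1⟩, fun hG => h.1 ?_⟩, fun h => ⟨h.1.2, h.1.1⟩⟩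
        exact F.2.subset_ground.antisymm (hG ▸ h.2)
    _ = ∑ G ∈ Finset.univ.filter (fun G : Flats M => G.1 ≠ M.E),
          -((-1) ^ rk M G.1 * recKL (M.restrict G.1) * chiRev M G.1 M.E) := by
        refine Finset.sum_congr rfl fun G hG => ?_
        rw [Finset.mem_filter] at hG
        have hk := sum_chiRev_mul_chi M G hG.2
        have htop : Finset.univ.filter (fun F : Flats M => G ≤ F) =
            insert ⟨M.E, M.ground_isFlat⟩
              (Finset.univ.filter (fun F : Flats M => G ≤ F ∧ F.1 ≠ M.E)) := by
          ext F
          simp only [Finset.mem_filter, Finset.mem_univ, true_and, Finset.mem_insert,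
            Subtype.ext_iff]
          constructor
          · intro hF
            by_cases hFE : F.1 = M.E
            · exact Or.inl hFE
            · exact Or.inr ⟨hF, hFE⟩
          · rintro (hF | hF)
            · exact fun e he => hF ▸ G.2.subset_ground he
            · exact hF.1
        rw [htop, Finset.sum_insert (by simp)] at hk
        have hself : chi M M.E M.E = 1 := by
          rw [← reflect_chiRev, chiRev_self]
          simp
        rw [hself, mul_one] at hk
        simp only [mul_assoc]
        rw [← Finset.mul_sum, ← Finset.mul_sum, eq_neg_of_add_eq_zero_right hk]
        ring
    _ = -properSum recKL M := by rw [properSum, Finset.sum_neg_distrib]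

/-- By induction the proper part is antipalindromic, hence it is its lower half minus the reflection
of that half. This is the recursion, up to sign. -/
theorem recursion_recKL (M : Matroid α) : Recursion recKL M := by
  induction hn : M.E.ncard using Nat.strong_induction_on generalizing M with | _ n ih =>
  subst hn
  rcases (rank M).eq_zero_or_pos with h | h
  -- In rank zero the ground set is the only flat.
  · have hp : properSum recKL M = 0 := by
      rw [properSum]
      refine Finset.sum_eq_zero fun F hF => ?_
      rw [Finset.mem_filter] at hF
      refine absurd ((rk_eq_rank_iff_of_isFlat M F.2).1 ?_) hF.2
      have := rk_le_rank M F.1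
      omega
    rw [Recursion, hp, h, recKL, if_pos h]
    split_ifs <;> simp
  · have hrefl := reflect_properSum (M := M) fun F hF =>
      ih _ (Set.ncard_lt_ncard (F.2.subset_ground.ssubset_of_ne hF) (Set.toFinite _)) _ rfl
    have hlow := lowerHalf_sub_reflect hrefl
    have hsign : ((-1) ^ rank M * (-1) ^ (rank M + 1) : ℤ[X]) = -1 := by
      rw [pow_succ, ← mul_assoc, ← mul_pow]
      simp
    rw [Recursion, recKL_of_pos h, neg_one_pow_mul_reflect]
    simp only [← mul_assoc]
    rw [hsign]
    linear_combination hlow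

theorem isInverseKL_recKL : IsInverseKL (recKL : Matroid α → ℤ[X]) where
  rank_zero_of_empty M h h' := by rw [recKL, if_pos h, if_pos h']
  rank_zero_of_nonempty M h h' := by rw [recKL, if_pos h, if_neg h'.ne_empty]
  degree_lt M h := by
    rw [recKL_of_pos h]
    have h1 := natDegree_lowerHalf_lt h (properSum recKL M)
    have h2 : (((-1) ^ (rank M + 1) : ℤ[X])) = C ((-1) ^ (rank M + 1)) := by simp
    have h3 := natDegree_C_mul_le ((-1) ^ (rank M + 1)) (lowerHalf (rank M) (properSum recKL M))
    rw [h2]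
    omega
  recursion M := by
    rw [recursion_sum_eq]
    exact recursion_recKL M

/-- Existence is what gives the choice in `inverseKL` its meaning. From here on only the defining
conditions are used. -/
theorem isInverseKL_inverseKL : IsInverseKL (inverseKL : Matroid α → ℤ[X]) :=
  Classical.epsilon_spec (p := fun Q : Matroid α → ℤ[X] => IsInverseKL Q) ⟨_, isInverseKL_recKL⟩

/-- The coefficients of the inverse Kazhdan–Lusztig polynomial in terms of the proper flats. -/
theorem coeff_inverseKL {M : Matroid α} (h : 0 < rank M) (i : ℕ) :
    (inverseKL M).coeff i =
      if 2 * i < rank M then (-1) ^ (rank M + 1) * (properSum inverseKL M).coeff i else 0 := by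
  have hdeg := isInverseKL_inverseKL.degree_lt M h
  split_ifs with hi
  · have hrec := isInverseKL_inverseKL.recursion M
    rw [recursion_sum_eq] at hrec
    have h2 : (((-1) ^ rank M : ℤ[X])) = C ((-1) ^ rank M) := by simp
    have hc := congrArg (fun q => q.coeff i) hrec
    simp only [coeff_add, h2, coeff_C_mul, coeff_reflect] at hc
    -- Since 2i < r, the degree r - i exceeds r/2 and so the degree of Q; the reflected term does
    -- not contribute.
    rw [revAt_le (by omega), coeff_eq_zero_of_natDegree_lt (n := rank M - i) (by omega),
      mul_zero] at hc
    have hsq : ((-1) ^ rank M * (-1) ^ rank M : ℤ) = 1 := by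
      rw [← mul_pow]; simp
    rw [pow_succ]
    linear_combination -((-1) ^ rank M : ℤ) * hc - (inverseKL M).coeff i * hsq
  · exact coeff_eq_zero_of_natDegree_lt (by omega)

/-- The flats as finite sets. -/
theorem properSum_eq (Q : Matroid α → ℤ[X]) (M : Matroid α) :
    properSum Q M = ∑ F ∈ Finset.univ.filter (fun F : Finset α => M.IsFlat F ∧ (F : Set α) ≠ M.E),
      (-1) ^ rk M F * Q (M.restrict F) * chiRev M F M.E := by
  rw [properSum]
  refine Finset.sum_bij' (fun F _ => F.1.toFinset)
    (fun F hF => ⟨F, (Finset.mem_filter.1 hF).2.1⟩) ?_ ?_ ?_ ?_ ?_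
  · intro F hF
    simp only [Finset.mem_filter, Finset.mem_univ, true_and, Set.coe_toFinset] at hF ⊢
    exact ⟨F.2, hF⟩
  · intro F hF
    simp only [Finset.mem_filter, Finset.mem_univ, true_and] at hF ⊢
    exact hF.2
  · intro F _
    simp
  · intro F _
    simp
  · intro F _
    simp

end Existence

/-! ### Alternating binomial sums and their relation to tableaux -/

section Binomial

/-- Partial alternating sums of products of binomial coefficients. -/
def altSum (n k i : ℕ) : ℤ :=
  ∑ m ∈ Finset.range k, (-1) ^ m * (n.choose m * m.choose i)

theorem altSum_succ (n k i : ℕ) :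
    altSum n (k + 1) i = altSum n k i + (-1) ^ k * (n.choose k * k.choose i) := by
  rw [altSum, Finset.sum_range_succ, altSum]

theorem altSum_eq_zero (n : ℕ) {k i : ℕ} (h : k ≤ i) : altSum n k i = 0 := by
  refine Finset.sum_eq_zero fun m hm => ?_
  rw [Finset.mem_range] at hm
  rw [Nat.choose_eq_zero_of_lt (hm.trans_le h)]
  simp

/-- The identity C(n,m) C(m,i) = C(n,i) C(n-i,m-i) reduces this to a partial alternating row sum of
Pascal's triangle, which telescopes. The parameters stand for N = n - i - 1 and d = k - i - 1. -/
theorem altSum_eq (N i d : ℕ) : altSum (N + i + 1) (i + d + 1) i =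
    (-1) ^ (i + d) * ((N + i + 1).choose i * N.choose d) := by
  induction d with
  | zero =>
    rw [add_zero, altSum_succ, altSum_eq_zero _ le_rfl]
    simp
  | succ d ih =>
    rw [show i + (d + 1) + 1 = (i + d + 1) + 1 by ring, altSum_succ, ih]
    have h1 : (N + i + 1).choose (i + d + 1) * (i + d + 1).choose i =
        (N + i + 1).choose i * (N + 1).choose (d + 1) := by
      rw [Nat.choose_mul (by omega)]
      congr 2 <;> omega
    have h2 : ((N + i + 1).choose (i + d + 1) * (i + d + 1).choose i : ℤ) =
        (N + i + 1).choose i * (N.choose d + N.choose (d + 1)) := by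
      rw [Nat.choose_succ_succ' N d] at h1
      exact_mod_cast h1
    rw [h2, show i + (d + 1) = i + d + 1 by ring, pow_succ]
    ring

theorem altSum_of_lt {n k i : ℕ} (hik : i < k) (hin : i < n) :
    altSum n k i = (-1) ^ (k + 1) * (n.choose i * (n - i - 1).choose (k - i - 1)) := by
  have := altSum_eq (n - i - 1) i (k - i - 1)
  rw [show n - i - 1 + i + 1 = n by omega, show i + (k - i - 1) + 1 = k by omega] at this
  rw [this, show k + 1 = i + (k - i - 1) + 2 by omega, pow_add _ _ 2, neg_one_sq, mul_one]

theorem altSum_total {n i : ℕ} (h : i < n) : altSum n (n + 1) i = 0 := by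
  rw [altSum_of_lt (by omega) h, Nat.choose_eq_zero_of_lt (by omega : n - i - 1 < n + 1 - i - 1)]
  simp

/-- Both sums evaluate to products of two binomials, which are those of `syt_succ`. For i = 0 the
second sum vanishes. -/
theorem syt_eq_altSum {n k i : ℕ} (hkn : k ≤ n) (hi : 2 * i < k) :
    (syt (n - k + 1) i (k - 2 * i - 1) : ℤ) =
      (-1) ^ (k + 1) * (altSum n k i - altSum n k (k - i)) := by
  have hs : ((-1) ^ (k + 1) * (-1) ^ (k + 1) : ℤ) = 1 := by
    rw [← mul_pow]; simp
  cases i with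
  | zero =>
    rw [syt_zero, altSum_eq_zero n (by omega : k ≤ k - 0), altSum_of_lt (by omega) (by omega),
      show n - k + (k - 2 * 0 - 1) = n - 0 - 1 by omega, show k - 2 * 0 - 1 = k - 0 - 1 by omega]
    rw [sub_zero, ← mul_assoc, hs]
    simp
  | succ i =>
    rw [syt_succ (n := n) (p := n - (i + 1) - 1) (s := k - (i + 1) - 1) (l := n - (k - (i + 1)) - 1)
      (n - k) i _ (by omega) (by omega) (by omega) (by omega),
      altSum_of_lt (by omega) (by omega), altSum_of_lt (by omega) (by omega),
      ← mul_sub, ← mul_assoc, hs, one_mul, show k - (i + 1) - 1 + 1 = k - (i + 1) by omega,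
      show k - (k - (i + 1)) - 1 = i by omega]

/-- For i > 0, removing the maximum leaves shapes with h boxes or h - 1 boxes in the tableau
formula's respective parameters k and k - 1, both with n = h there. The sums with the complementary
indices cancel, apart from a boundary term that extends the remaining sum to length k. -/
theorem sytBar_eq_altSum {h k i : ℕ} (hkh : k ≤ h) (hi : 2 * i < k) :
    (sytBar (h + 2 - k) i (k - 2 * i - 1) : ℤ) =
      (-1) ^ (k + 1) * (altSum h k i - if i = 0 then 0 else altSum h k (i - 1)) := by
  obtain ⟨k, rfl⟩ : ∃ k', k = k' + 1 := ⟨k - 1, by omega⟩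
  have h1 := syt_eq_altSum hkh hi
  rw [show h + 2 - (k + 1) = h - (k + 1) + 2 by omega]
  cases i with
  | zero =>
    rw [sytBar_zero, h1, if_pos rfl, altSum_eq_zero h (by omega : k + 1 ≤ k + 1 - 0)]
  | succ i =>
    have h2 := syt_eq_altSum (n := h) (k := k) (i := i) (by omega) (by omega)
    have h3 : (k.choose (k - i) : ℤ) = k.choose i := by rw [Nat.choose_symm (by omega)]
    rw [sytBar_succ, Nat.cast_add, h1, if_neg (by omega), add_tsub_cancel_right,
      show h - (k + 1) + 2 = h - k + 1 by omega,
      show k + 1 - 2 * (i + 1) - 1 + 1 = k - 2 * i - 1 by omega, h2,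
      show k + 1 - (i + 1) = k - i by omega, altSum_succ h k (k - i), altSum_succ h k i, h3]
    ring

end Binomial

/-! ### Uniform matroids -/

section Uniform

open scoped Classical

/-- For a set `A` of size `m` this counts the proper flats F ⊆ A that contribute in degree `i`:
those of size m - i if m < k, and of size k - i if m ≥ k. In the second case i = 0 would force |F| =
k, which is not allowed. -/
theorem sum_choose_ite {m k i : ℕ} (hik : i < k) :
    ∑ j ∈ Finset.range (m + 1), (m.choose j : ℤ) * (if j < k ∧ i = min m k - j then 1 else 0) =
      if m < k then (m.choose i : ℤ) else if 0 < i then (m.choose (k - i) : ℤ) else 0 := by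
  split_ifs with h1 h2
  · by_cases him : i ≤ m
    · rw [Finset.sum_eq_single (m - i), if_pos (by omega), mul_one, Nat.choose_symm him]
      · intro j hj hne
        rw [Finset.mem_range] at hj
        rw [if_neg (by omega), mul_zero]
      · intro hj
        rw [Finset.mem_range] at hj
        omega
    · rw [Nat.choose_eq_zero_of_lt (by omega)]
      refine Finset.sum_eq_zero fun j hj => ?_
      rw [if_neg (by omega), mul_zero]
  · rw [Finset.sum_eq_single (k - i), if_pos (by omega), mul_one]
    · intro j hj hne
      rw [if_neg (by omega), mul_zero]
    · intro hj
      rw [Finset.mem_range] at hj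
      omega
  · refine Finset.sum_eq_zero fun j hj => ?_
    rw [if_neg (by omega), mul_zero]

variable {α : Type u} [Fintype α]

/-- The rank function of a uniform matroid of rank `k` on `n` elements. -/
structure IsUniform (M : Matroid α) (k n : ℕ) : Prop where
  rk_eq : ∀ X ⊆ M.E, rk M X = min X.ncard k
  ncard_eq : M.E.ncard = n
  le : k ≤ n

variable {M : Matroid α} {k n : ℕ}

theorem IsUniform.rank_eq (h : IsUniform M k n) : rank M = k := by
  rw [rank, h.rk_eq _ subset_rfl, h.ncard_eq, min_eq_right h.le]

theorem IsUniform.proper_flat_iff (h : IsUniform M k n) (F : Set α) :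
    (M.IsFlat F ∧ F ≠ M.E) ↔ F ⊆ M.E ∧ F.ncard < k := by
  constructor
  · rintro ⟨hF, hne⟩
    refine ⟨hF.subset_ground, ?_⟩
    have h1 := (rk_eq_rank_iff_of_isFlat M hF).not.2 hne
    rw [h.rk_eq F hF.subset_ground, h.rank_eq] at h1
    omega
  · rintro ⟨hF, hlt⟩
    refine ⟨(isFlat_iff_rk M).2 ⟨hF, fun e he => ?_⟩, ?_⟩
    · rw [h.rk_eq _ (Set.insert_subset he.1 hF), h.rk_eq _ hF,
        Set.ncard_insert_of_notMem he.2 (Set.toFinite _)]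
      omega
    · rintro rfl
      have := h.ncard_eq
      have := h.le
      omega

theorem IsUniform.restrict (h : IsUniform M k n) {F : Set α} (hF : F ⊆ M.E) (hlt : F.ncard < k) :
    IsUniform (M.restrict F) F.ncard F.ncard where
  rk_eq X hX := by
    have hX' : X ⊆ F := hX
    rw [rk_restrict M hX', h.rk_eq X (hX'.trans hF)]
    have := Set.ncard_le_ncard hX' (Set.toFinite _)
    omega
  ncard_eq := rfl
  le := le_rfl

theorem coeff_sign_mul_chiRev (M : Matroid α) (r : ℕ) (F G : Set α) (i : ℕ) :
    ((-1) ^ r * chiRev M F G).coeff i = ∑ A ∈ between F G,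
      if i = rk M A - rk M F then (-1) ^ r * relSign F A else 0 := by
  have h2 : (((-1) ^ r : ℤ[X])) = C ((-1) ^ r) := by simp
  rw [h2, coeff_C_mul, chiRev, finsetSum_coeff, Finset.mul_sum]
  refine Finset.sum_congr rfl fun A _ => ?_
  rw [coeff_C_mul_X_pow]
  split_ifs <;> simp

theorem neg_one_pow_mul_relSign (F A : Finset α) :
    (-1) ^ F.card * relSign (F : Set α) A = (-1) ^ A.card := by
  rw [relSign, Set.ncard_coe_finset, ← pow_add, show F.card + (A.card + F.card) =
    2 * F.card + A.card by ring, pow_add, pow_mul]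
  simp

/-- Exchanging the sums over the flats F and the sets A ⊇ F turns the coefficient into a sum over
|A|. Sets with fewer than k elements give the first alternating sum, the others give the second. -/
theorem IsUniform.coeff_properSum (h : IsUniform M k n)
    (hQ : ∀ F ⊆ M.E, F.ncard < k → inverseKL (M.restrict F) = 1) {i : ℕ} (hi : i < k) :
    (properSum inverseKL M).coeff i = altSum n k i - altSum n k (k - i) := by
  have hstep : (properSum inverseKL M).coeff i = ∑ A ∈ M.E.toFinset.powerset, (-1) ^ A.card *
      ∑ j ∈ Finset.range (A.card + 1), (A.card.choose j : ℤ) *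
        (if j < k ∧ i = min A.card k - j then 1 else 0) := by
    calc (properSum inverseKL M).coeff i
        = ∑ F ∈ Finset.univ.filter (fun F : Finset α => (F : Set α) ⊆ M.E ∧ F.card < k),
            ∑ A ∈ between F M.E, if i = min A.card k - F.card then (-1) ^ A.card else 0 := by
          rw [properSum_eq, finsetSum_coeff]
          refine Finset.sum_congr ?_ fun F hF => ?_
          · ext F
            simp only [Finset.mem_filter, Finset.mem_univ, true_and]
            rw [h.proper_flat_iff, Set.ncard_coe_finset]
          · simp only [Finset.mem_filter, Finset.mem_univ, true_and] at hF
            have hrkF : rk M F = F.card := by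
              rw [h.rk_eq _ hF.1, Set.ncard_coe_finset]
              omega
            rw [hQ F hF.1 (by rw [Set.ncard_coe_finset]; exact hF.2), mul_one,
              coeff_sign_mul_chiRev]
            refine Finset.sum_congr rfl fun A hA => ?_
            rw [mem_between] at hA
            rw [hrkF, neg_one_pow_mul_relSign, h.rk_eq _ hA.2, Set.ncard_coe_finset]
      _ = ∑ A ∈ M.E.toFinset.powerset, ∑ F ∈ A.powerset.filter (fun F => F.card < k),
            if i = min A.card k - F.card then (-1) ^ A.card else 0 := by
          refine Finset.sum_comm' fun F A => ?_
          simp only [Finset.mem_filter, Finset.mem_univ, true_and, mem_between,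
            Finset.mem_powerset, ← Finset.coe_subset, Set.coe_toFinset]
          exact ⟨fun h => ⟨⟨h.2.1, h.1.2⟩, h.2.2⟩, fun h => ⟨⟨h.1.1.trans h.2, h.1.2⟩, h.1.1, h.2⟩⟩
      _ = _ := by
          refine Finset.sum_congr rfl fun A _ => ?_
          rw [Finset.sum_filter, Finset.mul_sum]
          have := Finset.sum_powerset_apply_card (x := A) (fun j =>
            if j < k then if i = min A.card k - j then ((-1) ^ A.card : ℤ) else 0 else 0)
          rw [this]
          refine Finset.sum_congr rfl fun j _ => ?_
          rw [nsmul_eq_mul]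
          by_cases h1 : j < k <;> by_cases h2 : i = min A.card k - j <;> simp [h1, h2, mul_comm]
  rw [hstep, Finset.sum_powerset_apply_card (fun m => (-1) ^ m *
      ∑ j ∈ Finset.range (m + 1), (m.choose j : ℤ) *
        (if j < k ∧ i = min m k - j then 1 else 0)), ← Set.ncard_eq_toFinset_card', h.ncard_eq]
  simp only [sum_choose_ite hi, nsmul_eq_mul]
  have hn : n + 1 = k + (n + 1 - k) := by have := h.le; omega
  have htail : ∀ j, altSum n (n + 1) j = altSum n k j + ∑ m ∈ Finset.range (n + 1 - k),
      (-1) ^ (k + m) * (n.choose (k + m) * (k + m).choose j : ℤ) := by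
    intro j
    rw [altSum, hn, Finset.sum_range_add, altSum, ← hn]
  rw [hn, Finset.sum_range_add]
  have h1 : ∑ m ∈ Finset.range k, (n.choose m : ℤ) * ((-1) ^ m *
      if m < k then (m.choose i : ℤ) else if 0 < i then (m.choose (k - i) : ℤ) else 0) =
      altSum n k i := by
    refine Finset.sum_congr rfl fun m hm => ?_
    rw [Finset.mem_range] at hm
    rw [if_pos hm]
    ring
  rw [h1, sub_eq_add_neg]
  congr 1
  rcases i.eq_zero_or_pos with rfl | hpos
  · rw [altSum_eq_zero n (by omega : k ≤ k - 0), neg_zero]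
    refine Finset.sum_eq_zero fun m _ => ?_
    rw [if_neg (by omega), if_neg (by omega)]
    ring
  -- The alternating sum over all m vanishes, so its tail from k on is minus its initial part.
  · have h2 := htail (k - i)
    rw [altSum_total (by have := h.le; omega)] at h2
    rw [eq_neg_iff_add_eq_zero, add_comm, h2]
    congr 1
    refine Finset.sum_congr rfl fun m _ => ?_
    rw [if_neg (by omega), if_pos hpos]
    ring

theorem inverseKL_of_ground_eq_empty (h : M.E = ∅) : inverseKL M = 1 :=
  isInverseKL_inverseKL.rank_zero_of_empty M (by rw [rank, h, rk_empty]) h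

/-- The two claims share one induction: the coefficient formula needs Q = 1 for smaller Boolean
matroids, and Q = 1 is the case k = n of the formula, where only a one-row shape has tableaux. -/
theorem IsUniform.coeff_inverseKL_and (h : IsUniform M k n) : (1 ≤ n → ∀ i,
    (inverseKL M).coeff i =
      if 2 * i < k then (-1) ^ (k + 1) * (altSum n k i - altSum n k (k - i)) else 0) ∧
    (k = n → inverseKL M = 1) := by
  induction n using Nat.strong_induction_on generalizing M k with | _ n ih =>
  have hQ : ∀ F ⊆ M.E, F.ncard < k → inverseKL (M.restrict F) = 1 := fun F hF hlt =>
    (ih F.ncard (hlt.trans_le h.le) (h.restrict hF hlt)).2 rfl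
  have hmain : 1 ≤ n → ∀ i, (inverseKL M).coeff i =
      if 2 * i < k then (-1) ^ (k + 1) * (altSum n k i - altSum n k (k - i)) else 0 := by
    intro hn i
    rcases k.eq_zero_or_pos with rfl | hk
    · rw [isInverseKL_inverseKL.rank_zero_of_nonempty M h.rank_eq]
      · simp
      · rw [← Set.ncard_pos, h.ncard_eq]; exact hn
    · rw [coeff_inverseKL (by rw [h.rank_eq]; exact hk), h.rank_eq]
      split_ifs with hi
      · rw [h.coeff_properSum hQ (by omega)]
      · rfl
  refine ⟨hmain, ?_⟩
  rintro rfl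
  rcases k.eq_zero_or_pos with rfl | hk
  -- On the empty ground set Q = 1 is an initial condition, not covered by the formula.
  · exact inverseKL_of_ground_eq_empty ((Set.ncard_eq_zero (Set.toFinite _)).1 h.ncard_eq)
  · ext i
    rw [hmain hk, coeff_one]
    by_cases hi : 2 * i < k
    · rw [if_pos hi, ← syt_eq_altSum le_rfl hi, Nat.sub_self, zero_add]
      cases i with
      | zero => simp [syt_one_zero]
      | succ i => simp [syt_one_succ]
    · rw [if_neg hi, if_neg (by omega)]

theorem IsUniform.coeff_inverseKL (h : IsUniform M k n) (hn : 1 ≤ n) (i : ℕ) :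
    (inverseKL M).coeff i =
      if 2 * i < k then (-1) ^ (k + 1) * (altSum n k i - altSum n k (k - i)) else 0 :=
  h.coeff_inverseKL_and.1 hn i

theorem IsUniform.inverseKL_eq_one (h : IsUniform M n n) : inverseKL M = 1 :=
  h.coeff_inverseKL_and.2 rfl

theorem coeff_sum_range_C_mul (m : ℕ) (f : ℕ → ℤ) (i : ℕ) :
    (∑ j ∈ Finset.range m, C (f j) * X ^ j : ℤ[X]).coeff i = if i < m then f i else 0 := by
  rw [finsetSum_coeff]
  simp [coeff_X_pow]

theorem IsUniform.inverseKL_eq (h : IsUniform M k n) (hn : 1 ≤ n) :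
    inverseKL M = ∑ i ∈ Finset.range ((k + 1) / 2),
      C (syt (n - k + 1) i (k - 2 * i - 1) : ℤ) * X ^ i := by
  ext i
  rw [h.coeff_inverseKL hn, coeff_sum_range_C_mul]
  by_cases hi : 2 * i < k
  · rw [if_pos hi, if_pos (by omega), syt_eq_altSum h.le hi]
  · rw [if_neg hi, if_neg (by omega)]

theorem indep_uniform_iff (k n : ℕ) (hkn : k ≤ n) (I : Set (Fin n)) :
    (uniform k n hkn).Indep I ↔ I.ncard ≤ k := by
  rw [Matroid.indep_iff]
  constructor
  · rintro ⟨B, hB, hIB⟩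
    have hB' : B.ncard = k := hB
    rw [← hB']
    exact Set.ncard_le_ncard hIB (Set.toFinite _)
  · intro h
    obtain ⟨B, hIB, -, hB⟩ := Set.exists_subsuperset_card_eq (Set.subset_univ I) h
      (by rwa [Set.ncard_univ, Nat.card_fin])
    exact ⟨B, hB, hIB⟩

theorem rk_eq_of_indep_iff (M : Matroid α) (X : Set α) (r : ℕ)
    (h : ∀ I ⊆ X, M.Indep I ↔ I.ncard ≤ r) : rk M X = min X.ncard r := by
  obtain ⟨I, hI⟩ := M.exists_isBasis' X
  have h1 : rk M X = I.ncard := by rw [rk, hI.eRk_eq_encard, Set.ncard_def]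
  refine le_antisymm (le_min (rk_le_ncard M X) ?_) ?_
  · rw [h1]
    exact (h I hI.subset).1 hI.indep
  · obtain ⟨J, hJX, hJ⟩ := Set.exists_subset_card_eq (min_le_left X.ncard r)
    have hind := (h J hJX).2 (hJ.trans_le (min_le_right _ _))
    rw [← hJ, ← (indep_iff_rk M).1 hind]
    exact rk_mono M hJX

theorem isUniform_uniform (k n : ℕ) (hkn : k ≤ n) : IsUniform (uniform k n hkn) k n where
  rk_eq X _ := rk_eq_of_indep_iff _ _ _ fun I _ => indep_uniform_iff k n hkn I
  ncard_eq := by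
    have : (uniform k n hkn).E = Set.univ := rfl
    rw [this, Set.ncard_univ, Nat.card_fin]
  le := hkn

end Uniform

/-! ### Stressed hyperplanes and their relaxation -/

section Relaxation

open scoped Classical

variable {α : Type u} [Fintype α]

/-- The reversed characteristic polynomial of a contraction by a hyperplane. -/
theorem chiRev_hyperplane (M : Matroid α) {F : Set α} (hF : M.IsFlat F)
    (hrk : rk M F + 1 = rank M) : chiRev M F M.E = 1 - X := by
  have hmem : F.toFinset ∈ between F M.E := by
    rw [mem_between, Set.coe_toFinset]
    exact ⟨subset_rfl, hF.subset_ground⟩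
  have hne : F ≠ M.E := by
    rintro rfl
    rw [rank] at hrk
    omega
  have hsum := sum_between_relSign hF.subset_ground
  rw [if_neg hne, ← Finset.add_sum_erase _ _ hmem] at hsum
  have hself : relSign F F.toFinset = 1 := by
    rw [relSign, Set.ncard_eq_toFinset_card', ← two_mul, pow_mul]
    simp
  rw [chiRev, ← Finset.add_sum_erase _ _ hmem, hself, Set.coe_toFinset, Nat.sub_self,
    Finset.sum_congr rfl (g := fun A => C (relSign F A) * X), ← Finset.sum_mul, ← map_sum,
    eq_neg_of_add_eq_zero_right hsum, hself]
  · simp [sub_eq_add_neg]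
  · intro A hA
    rw [Finset.mem_erase, mem_between] at hA
    obtain ⟨hAF, hFA, hAE⟩ := hA
    have hss : F ⊂ A := hFA.ssubset_of_ne (by rintro rfl; exact hAF (by simp))
    obtain ⟨e, heA, heF⟩ := Set.exists_of_ssubset hss
    have h1 := ((isFlat_iff_rk M).1 hF).2 e ⟨hAE heA, heF⟩
    have h2 := rk_mono M (Set.insert_subset heA hFA)
    have h3 := rk_le_rank M A
    rw [show rk M A - rk M F = 1 by omega, pow_one]

theorem closure_eq_of_rk_le (M : Matroid α) {X F : Set α} (hF : M.IsFlat F) (hXF : X ⊆ F)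
    (h : rk M F ≤ rk M X) : M.closure X = F := by
  have hfl := M.isFlat_closure X
  refine ((closure_subset_iff M hF (hXF.trans hF.subset_ground)).2 hXF).antisymm fun e he => ?_
  by_contra hcon
  have h1 := ((isFlat_iff_rk M).1 hfl).2 e ⟨hF.subset_ground he, hcon⟩
  have h2 := rk_mono M (Set.insert_subset he
    ((closure_subset_iff M hF (hXF.trans hF.subset_ground)).2 hXF))
  rw [rk_closure] at h1
  omega

variable {M : Matroid α} {H : Set α} (hH : IsStressedHyperplane M H)

namespace IsStressedHyperplane

include hH

theorem indep_iff {I : Set α} (hI : I ⊆ H) : M.Indep I ↔ I.ncard ≤ rank M - 1 := by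
  have hrk := hH.rk_add_one
  constructor
  · intro h
    rw [indep_iff_rk] at h
    have := rk_mono M hI
    omega
  · intro h
    by_cases hk : rank M ≤ H.ncard
    · obtain ⟨S, hIS, hSH, hS⟩ := Set.exists_subsuperset_card_eq hI
        (show I.ncard ≤ rank M by omega) hk
      refine (hH.isCircuit S hSH hS).ssubset_indep (hIS.ssubset_of_ne ?_)
      rintro rfl
      omega
    -- Without subsets of size rk M the circuit condition is void; rk H = rk M - 1 then forces `H`
    -- itself to be independent.
    · have h1 := rk_le_ncard M H
      exact ((indep_iff_rk M).2 (by omega : rk M H = H.ncard)).subset hI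

theorem rk_eq {X : Set α} (hX : X ⊆ H) : rk M X = min X.ncard (rank M - 1) :=
  rk_eq_of_indep_iff M X _ fun _ hI => hH.indep_iff (hI.trans hX)

theorem rk_insert {X : Set α} (hX : X ⊆ H) {e : α} (he : e ∈ M.E) (heH : e ∉ H) :
    rk M (insert e X) = rk M X + 1 := by
  have hXE := hX.trans hH.isFlat.subset_ground
  have hcl := (closure_subset_iff M hH.isFlat hXE).2 hX
  have h1 := ((isFlat_iff_rk M).1 (M.isFlat_closure X)).2 e ⟨he, fun h => heH (hcl h)⟩
  rw [← rk_closure M (insert e X), ← M.closure_insert_closure_eq_closure_insert, rk_closure, h1,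
    rk_closure]

theorem not_ground_subset : ¬ M.E ⊆ H := by
  intro h
  have h1 := rk_mono M h
  have := hH.rk_add_one
  rw [rank] at this
  omega

theorem relax_ground : (relax M H hH).E = M.E := rfl

theorem indep_relax_iff (I : Set α) :
    (relax M H hH).Indep I ↔ M.Indep I ∨ (I ⊆ H ∧ I.ncard ≤ rank M) := by
  have hrk := hH.rk_add_one
  rw [Matroid.indep_iff]
  constructor
  · rintro ⟨B, hB | ⟨hBH, hB⟩, hIB⟩
    · exact Or.inl (hB.indep.subset hIB)
    · exact Or.inr ⟨hIB.trans hBH, hB ▸ Set.ncard_le_ncard hIB (Set.toFinite _)⟩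
  · intro h
    by_cases hI : M.Indep I
    · obtain ⟨B, hB, hIB⟩ := hI.exists_isBase_superset
      exact ⟨B, Or.inl hB, hIB⟩
    · obtain ⟨hIH, hle⟩ := h.resolve_left hI
      rw [hH.indep_iff hIH] at hI
      have := Set.ncard_le_ncard hIH (Set.toFinite _)
      obtain ⟨S, hIS, hSH, hS⟩ := Set.exists_subsuperset_card_eq hIH hle (by omega)
      exact ⟨S, Or.inr ⟨hSH, hS⟩, hIS⟩

theorem rk_relax_of_subset {X : Set α} (hX : X ⊆ H) :
    rk (relax M H hH) X = min X.ncard (rank M) := by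
  refine rk_eq_of_indep_iff _ X _ fun I hI => ?_
  rw [hH.indep_relax_iff, hH.indep_iff (hI.trans hX)]
  have := hI.trans hX
  constructor
  · rintro (h | h)
    · omega
    · exact h.2
  · exact fun h => Or.inr ⟨this, h⟩

theorem rk_relax_of_not_subset {X : Set α} (hXE : X ⊆ M.E) (hX : ¬ X ⊆ H) :
    rk (relax M H hH) X = rk M X := by
  have hrk := hH.rk_add_one
  refine le_antisymm ?_ ?_
  · obtain ⟨I, hI⟩ := (relax M H hH).exists_isBasis' X
    have h1 : rk (relax M H hH) X = I.ncard := by rw [rk, hI.eRk_eq_encard, Set.ncard_def]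
    rw [h1]
    rcases (hH.indep_relax_iff I).1 hI.indep with h | ⟨hIH, hle⟩
    · rw [← (indep_iff_rk M).1 h]
      exact rk_mono M hI.subset
    -- A relaxed basis inside `H` has at most one element more than its rank in `M`, and an element
    -- of `X` outside `H` makes up for it.
    · obtain ⟨e, heX, heH⟩ := Set.not_subset.1 hX
      have h2 := hH.rk_insert hIH (hXE heX) heH
      have h3 := rk_mono M (Set.insert_subset heX hI.subset)
      rw [hH.rk_eq hIH] at h2
      omega
  · obtain ⟨I, hI⟩ := M.exists_isBasis' X
    have h1 : rk M X = I.ncard := by rw [rk, hI.eRk_eq_encard, Set.ncard_def]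
    rw [h1, ← (indep_iff_rk _).1 ((hH.indep_relax_iff I).2 (Or.inl hI.indep))]
    exact rk_mono _ hI.subset

theorem rank_relax : rank (relax M H hH) = rank M := by
  rw [rank, hH.relax_ground, hH.rk_relax_of_not_subset subset_rfl hH.not_ground_subset, rank]

theorem relax_eq_self (h : H.ncard < rank M) : relax M H hH = M := by
  refine Matroid.ext_indep rfl fun I _ => ?_
  rw [hH.indep_relax_iff, or_iff_left_iff_imp]
  rintro ⟨hIH, -⟩
  rw [hH.indep_iff hIH]
  have := Set.ncard_le_ncard hIH (Set.toFinite _)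
  omega

theorem proper_flat_iff {F : Set α} (hF : F ⊆ H) :
    (M.IsFlat F ∧ F ≠ M.E) ↔ F.ncard + 1 < rank M ∨ F = H := by
  have hrk := hH.rk_add_one
  have hne : F ≠ M.E := by
    rintro rfl
    exact hH.not_ground_subset hF
  rw [and_iff_left hne]
  constructor
  · intro hfl
    by_contra! hcon
    have := closure_eq_of_rk_le M hH.isFlat hF (by rw [hH.rk_eq hF]; omega)
    rw [hfl.closure] at this
    exact hcon.2 this
  · rintro (h | rfl)
    · refine (isFlat_iff_rk M).2 ⟨hF.trans hH.isFlat.subset_ground, fun e he => ?_⟩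
      by_cases heH : e ∈ H
      · rw [hH.rk_eq hF, hH.rk_eq (Set.insert_subset heH hF),
          Set.ncard_insert_of_notMem he.2 (Set.toFinite _)]
        omega
      · exact hH.rk_insert hF he.1 heH
    · exact hH.isFlat

theorem proper_flat_relax_iff {F : Set α} (hF : F ⊆ H) :
    ((relax M H hH).IsFlat F ∧ F ≠ M.E) ↔ F.ncard < rank M := by
  have hne : F ≠ M.E := by
    rintro rfl
    exact hH.not_ground_subset hF
  rw [and_iff_left hne]
  constructor
  · intro hfl
    have h1 := (rk_eq_rank_iff_of_isFlat _ hfl).not.2 hne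
    rw [hH.rank_relax, hH.rk_relax_of_subset hF] at h1
    omega
  · intro h
    refine (isFlat_iff_rk _).2 ⟨hF.trans hH.isFlat.subset_ground, fun e he => ?_⟩
    rw [hH.rk_relax_of_subset hF]
    by_cases heH : e ∈ H
    · rw [hH.rk_relax_of_subset (Set.insert_subset heH hF),
        Set.ncard_insert_of_notMem he.2 (Set.toFinite _)]
      omega
    · rw [hH.rk_relax_of_not_subset (Set.insert_subset he.1 (hF.trans hH.isFlat.subset_ground))
        (fun h => heH (h (Set.mem_insert _ _))), hH.rk_insert hF he.1 heH, hH.rk_eq hF]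
      omega

theorem isFlat_relax_iff {F : Set α} (hF : ¬ F ⊆ H) : (relax M H hH).IsFlat F ↔ M.IsFlat F := by
  rw [isFlat_iff_rk, isFlat_iff_rk, hH.relax_ground]
  refine and_congr_right fun hFE => forall₂_congr fun e he => ?_
  rw [hH.rk_relax_of_not_subset hFE hF, hH.rk_relax_of_not_subset (Set.insert_subset he.1 hFE)
    (fun h => hF ((Set.subset_insert _ _).trans h))]

/-- A proper flat has rank below rk M. If it contains a point outside `H`, then its subsets inside
`H` have rank at most rk M - 2, where the relaxation changes nothing. -/
theorem restrict_relax {F : Set α} (hF : ¬ F ⊆ H) (hfl : M.IsFlat F) (hne : F ≠ M.E) :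
    (relax M H hH).restrict F = M.restrict F := by
  refine eq_of_rk_eq rfl fun X hX => ?_
  have hXF : X ⊆ F := hX
  have hFE := hfl.subset_ground
  rw [rk_restrict _ hXF, rk_restrict _ hXF]
  by_cases hXH : X ⊆ H
  · obtain ⟨e, heF, heH⟩ := Set.not_subset.1 hF
    have h1 := hH.rk_insert hXH (hFE heF) heH
    have h2 := rk_mono M (Set.insert_subset heF hXF)
    have h3 := (rk_eq_rank_iff_of_isFlat _ hfl).not.2 hne
    have h4 := rk_le_rank M F
    rw [hH.rk_eq hXH] at h1
    rw [hH.rk_eq hXH, hH.rk_relax_of_subset hXH]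
    omega
  · exact hH.rk_relax_of_not_subset (hXF.trans hFE) hXH

theorem inverseKL_restrict {F : Set α} (hF : F ⊆ H) (hlt : F.ncard < rank M) :
    inverseKL (M.restrict F) = 1 := by
  refine IsUniform.inverseKL_eq_one (n := F.ncard) ⟨fun X hX => ?_, rfl, le_rfl⟩
  have hXF : X ⊆ F := hX
  have := Set.ncard_le_ncard hXF (Set.toFinite _)
  rw [rk_restrict _ hXF, hH.rk_eq (hXF.trans hF)]
  omega

theorem inverseKL_restrict_relax {F : Set α} (hF : F ⊆ H) (hlt : F.ncard < rank M) :
    inverseKL ((relax M H hH).restrict F) = 1 := by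
  refine IsUniform.inverseKL_eq_one (n := F.ncard) ⟨fun X hX => ?_, rfl, le_rfl⟩
  have hXF : X ⊆ F := hX
  have := Set.ncard_le_ncard hXF (Set.toFinite _)
  rw [rk_restrict _ hXF, hH.rk_relax_of_subset (hXF.trans hF)]
  omega

theorem isUniform_restrict : IsUniform (M.restrict H) (rank M - 1) H.ncard where
  rk_eq X hX := by
    have hXF : X ⊆ H := hX
    rw [rk_restrict _ hXF, hH.rk_eq hXF]
  ncard_eq := rfl
  le := by
    have := hH.rk_add_one
    have := rk_le_ncard M H
    omega

/-- Only the sets A ⊆ H with at least rk M elements change their rank, from rk M - 1 to rk M; each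
multiplies its monomial by X. -/
theorem chiRev_relax_sub {F : Finset α} (hF : (F : Set α) ⊆ H) (hlt : F.card + 1 < rank M) :
    chiRev (relax M H hH) F M.E - chiRev M F M.E = (X - 1) *
      ∑ A ∈ (between F H).filter (fun A => rank M ≤ A.card),
        C (relSign F A) * X ^ (rank M - 1 - F.card) := by
  rw [chiRev, chiRev, ← Finset.sum_sub_distrib, Finset.mul_sum]
  symm
  have hsub : (between F H).filter (fun A => rank M ≤ A.card) ⊆ between F M.E := by
    intro A hA
    rw [Finset.mem_filter, mem_between] at hA
    rw [mem_between]
    exact ⟨hA.1.1, hA.1.2.trans hH.isFlat.subset_ground⟩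
  rw [← Finset.sum_subset hsub]
  · refine Finset.sum_congr rfl fun A hA => ?_
    rw [Finset.mem_filter, mem_between] at hA
    rw [hH.rk_eq hF, hH.rk_relax_of_subset hF, hH.rk_eq hA.1.2, hH.rk_relax_of_subset hA.1.2,
      Set.ncard_coe_finset, Set.ncard_coe_finset,
      show min A.card (rank M) - min F.card (rank M) = rank M - 1 - F.card + 1 by omega,
      show min A.card (rank M - 1) - min F.card (rank M - 1) = rank M - 1 - F.card by omega]
    ring
  · intro A hA hA'
    rw [Finset.mem_filter, mem_between] at hA'
    rw [mem_between] at hA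
    rw [hH.rk_eq hF, hH.rk_relax_of_subset hF, Set.ncard_coe_finset]
    by_cases hAH : (A : Set α) ⊆ H
    · have : A.card < rank M := by
        by_contra! h
        exact hA' ⟨⟨hA.1, hAH⟩, h⟩
      rw [hH.rk_eq hAH, hH.rk_relax_of_subset hAH, Set.ncard_coe_finset,
        show min A.card (rank M) - min F.card (rank M) =
          min A.card (rank M - 1) - min F.card (rank M - 1) by omega, sub_self]
    · rw [hH.rk_relax_of_not_subset hA.2 hAH,
        show min F.card (rank M) = min F.card (rank M - 1) by omega, sub_self]

/-- The contribution of the flats of small rank contained in the hyperplane. -/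
theorem coeff_sum_small {i : ℕ} (hle : rank M ≤ H.ncard) (hi : i < rank M) :
    (∑ F ∈ Finset.univ.filter (fun F : Finset α => (F : Set α) ⊆ H ∧ F.card + 1 < rank M),
      (-1) ^ F.card * ∑ A ∈ (between F H).filter (fun A => rank M ≤ A.card),
        C (relSign F A) * X ^ (rank M - 1 - F.card) : ℤ[X]).coeff i =
      if 0 < i then -altSum H.ncard (rank M) (rank M - 1 - i) else 0 := by
  generalize rank M = k at hle hi
  -- For fixed `A` the exponent determines the size k - 1 - i of the flat, and i = 0 is excluded
  -- because the flats have fewer than k - 1 elements.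
  have hinner : ∀ m, k ≤ m → ∑ j ∈ Finset.range (m + 1),
      (m.choose j : ℤ) * (if j + 1 < k ∧ i = k - 1 - j then 1 else 0) =
      if 0 < i then (m.choose (k - 1 - i) : ℤ) else 0 := by
    intro m hm
    split_ifs with h0
    · rw [Finset.sum_eq_single (k - 1 - i), if_pos (by omega), mul_one]
      · intro j _ hne
        rw [if_neg (by omega), mul_zero]
      · intro hj
        rw [Finset.mem_range] at hj
        omega
    · refine Finset.sum_eq_zero fun j _ => ?_
      rw [if_neg (by omega), mul_zero]
  have h1 : (∑ F ∈ Finset.univ.filter (fun F : Finset α => (F : Set α) ⊆ H ∧ F.card + 1 < k),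
      (-1) ^ F.card * ∑ A ∈ (between F H).filter (fun A => k ≤ A.card),
        C (relSign F A) * X ^ (k - 1 - F.card) : ℤ[X]).coeff i =
      ∑ A ∈ H.toFinset.powerset, if k ≤ A.card then
        (-1) ^ A.card * (if 0 < i then (A.card.choose (k - 1 - i) : ℤ) else 0) else 0 := by
    calc (∑ F ∈ Finset.univ.filter (fun F : Finset α => (F : Set α) ⊆ H ∧ F.card + 1 < k),
          (-1) ^ F.card * ∑ A ∈ (between F H).filter (fun A => k ≤ A.card),
            C (relSign F A) * X ^ (k - 1 - F.card) : ℤ[X]).coeff i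
        = ∑ F ∈ Finset.univ.filter (fun F : Finset α => (F : Set α) ⊆ H ∧ F.card + 1 < k),
            ∑ A ∈ (between F H).filter (fun A => k ≤ A.card),
              if i = k - 1 - F.card then (-1) ^ A.card else 0 := by
          rw [finsetSum_coeff]
          refine Finset.sum_congr rfl fun F _ => ?_
          have h2 : (((-1) ^ F.card : ℤ[X])) = C ((-1) ^ F.card) := by simp
          rw [h2, coeff_C_mul, finsetSum_coeff, Finset.mul_sum]
          refine Finset.sum_congr rfl fun A _ => ?_
          rw [coeff_C_mul_X_pow, mul_ite, mul_zero, neg_one_pow_mul_relSign]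
      _ = ∑ A ∈ H.toFinset.powerset.filter (fun A => k ≤ A.card),
            ∑ F ∈ A.powerset.filter (fun F => F.card + 1 < k),
              if i = k - 1 - F.card then (-1) ^ A.card else 0 := by
          refine Finset.sum_comm' fun F A => ?_
          simp only [Finset.mem_filter, Finset.mem_univ, true_and, mem_between,
            Finset.mem_powerset, ← Finset.coe_subset, Set.coe_toFinset]
          constructor
          · rintro ⟨⟨h1, h2⟩, ⟨h3, h4⟩, h5⟩
            exact ⟨⟨h3, h2⟩, h4, h5⟩
          · rintro ⟨⟨h3, h2⟩, h4, h5⟩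
            exact ⟨⟨h3.trans h4, h2⟩, ⟨h3, h4⟩, h5⟩
      _ = _ := by
          rw [Finset.sum_filter]
          refine Finset.sum_congr rfl fun A _ => ?_
          by_cases hA : k ≤ A.card
          · rw [if_pos hA, if_pos hA, ← hinner _ hA, Finset.sum_filter, Finset.mul_sum]
            have := Finset.sum_powerset_apply_card (x := A) (fun j =>
              if j + 1 < k then if i = k - 1 - j then ((-1) ^ A.card : ℤ) else 0 else 0)
            rw [this]
            refine Finset.sum_congr rfl fun j _ => ?_
            rw [nsmul_eq_mul]
            by_cases h1 : j + 1 < k <;> by_cases h2 : i = k - 1 - j <;> simp [h1, h2, mul_comm]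
          · rw [if_neg hA, if_neg hA]
  rw [h1, Finset.sum_powerset_apply_card (fun m => if k ≤ m then
    (-1) ^ m * (if 0 < i then (m.choose (k - 1 - i) : ℤ) else 0) else 0),
    ← Set.ncard_eq_toFinset_card']
  by_cases h0 : 0 < i
  -- Completing to the full alternating sum, which is zero, trades the sizes m ≥ k for m < k.
  · have htot := altSum_total (n := H.ncard) (i := k - 1 - i) (by omega)
    have hn : H.ncard + 1 = k + (H.ncard + 1 - k) := by omega
    rw [altSum, hn, Finset.sum_range_add] at htot
    rw [if_pos h0, hn, Finset.sum_range_add, Finset.sum_eq_zero (s := Finset.range k), zero_add,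
      eq_neg_iff_add_eq_zero, ← htot, altSum, add_comm]
    · congr 1
      refine Finset.sum_congr rfl fun m _ => ?_
      rw [if_pos (by omega), if_pos h0, nsmul_eq_mul]
      ring
    · intro m hm
      rw [Finset.mem_range] at hm
      rw [if_neg (by omega), smul_zero]
  · rw [if_neg h0]
    refine Finset.sum_eq_zero fun m _ => ?_
    simp [h0]

/-- Below `H` the proper flats are the sets with fewer than rk M - 1 elements, with Boolean
restrictions, and `H` itself. The terms not below `H` are kept apart since relaxation preserves
them. -/
theorem properSum_eq_of_stressed : properSum inverseKL M =
    ∑ F ∈ Finset.univ.filter (fun F : Finset α =>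
      (M.IsFlat F ∧ (F : Set α) ≠ M.E) ∧ ¬ (F : Set α) ⊆ H),
        (-1) ^ rk M F * inverseKL (M.restrict F) * chiRev M F M.E +
    (∑ F ∈ Finset.univ.filter (fun F : Finset α => (F : Set α) ⊆ H ∧ F.card + 1 < rank M),
      (-1) ^ F.card * chiRev M F M.E +
    (-1) ^ (rank M - 1) * inverseKL (M.restrict H) * (1 - X)) := by
  have hrk := hH.rk_add_one
  rw [properSum_eq, ← Finset.sum_filter_not_add_sum_filter _
    (fun F : Finset α => (F : Set α) ⊆ H), Finset.filter_filter, Finset.filter_filter]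
  congr 1
  have hset : Finset.univ.filter (fun F : Finset α =>
      (M.IsFlat F ∧ (F : Set α) ≠ M.E) ∧ (F : Set α) ⊆ H) = insert H.toFinset
        (Finset.univ.filter (fun F : Finset α => (F : Set α) ⊆ H ∧ F.card + 1 < rank M)) := by
    ext F
    simp only [Finset.mem_filter, Finset.mem_univ, true_and, Finset.mem_insert]
    rw [← Finset.coe_inj, Set.coe_toFinset, ← Set.ncard_coe_finset]
    constructor
    · rintro ⟨h1, h2⟩
      exact ((hH.proper_flat_iff h2).1 h1).symm.imp id fun h => ⟨h2, h⟩
    · rintro (h | ⟨h1, h2⟩)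
      · exact ⟨(hH.proper_flat_iff h.subset).2 (Or.inr h), h.subset⟩
      · exact ⟨(hH.proper_flat_iff h1).2 (Or.inl h2), h1⟩
  rw [hset, Finset.sum_insert, Set.coe_toFinset, chiRev_hyperplane M hH.isFlat hrk, add_comm,
    show rk M H = rank M - 1 by omega]
  · congr 1
    refine Finset.sum_congr rfl fun F hF => ?_
    simp only [Finset.mem_filter, Finset.mem_univ, true_and] at hF
    rw [hH.inverseKL_restrict hF.1 (by rw [Set.ncard_coe_finset]; omega), mul_one,
      hH.rk_eq hF.1, Set.ncard_coe_finset, min_eq_left (by omega)]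
  · simp only [Finset.mem_filter, Finset.mem_univ, true_and, not_and, not_lt]
    intro _
    have := rk_le_ncard M H
    rw [← Set.ncard_eq_toFinset_card']
    omega

/-- In place of `H`, all its subsets of size rk M - 1 are now hyperplanes with Boolean restriction,
each contributing the same multiple of 1 - X. -/
theorem properSum_relax_eq : properSum inverseKL (relax M H hH) =
    ∑ F ∈ Finset.univ.filter (fun F : Finset α =>
      (M.IsFlat F ∧ (F : Set α) ≠ M.E) ∧ ¬ (F : Set α) ⊆ H),
        (-1) ^ rk M F * inverseKL (M.restrict F) * chiRev M F M.E +
    (∑ F ∈ Finset.univ.filter (fun F : Finset α => (F : Set α) ⊆ H ∧ F.card + 1 < rank M),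
      (-1) ^ F.card * chiRev (relax M H hH) F M.E +
    C ((-1) ^ (rank M - 1) * (H.ncard.choose (rank M - 1) : ℤ)) * (1 - X)) := by
  have hrk := hH.rk_add_one
  rw [properSum_eq, ← Finset.sum_filter_not_add_sum_filter _
    (fun F : Finset α => (F : Set α) ⊆ H), Finset.filter_filter, Finset.filter_filter,
    hH.relax_ground]
  refine congrArg₂ (· + ·) ?_ ?_
  · refine Finset.sum_congr ?_ fun F hF => ?_
    · ext F
      simp only [Finset.mem_filter, Finset.mem_univ, true_and]
      refine and_congr_left fun h => and_congr_left fun _ => hH.isFlat_relax_iff h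
    · simp only [Finset.mem_filter, Finset.mem_univ, true_and] at hF
      obtain ⟨⟨hfl, hne⟩, hFH⟩ := hF
      have hFE := hfl.subset_ground
      rw [hH.restrict_relax hFH hfl hne, hH.rk_relax_of_not_subset hFE hFH]
      congr 1
      rw [chiRev, chiRev]
      refine Finset.sum_congr rfl fun A hA => ?_
      rw [mem_between] at hA
      rw [hH.rk_relax_of_not_subset hFE hFH,
        hH.rk_relax_of_not_subset hA.2 (fun h => hFH (hA.1.trans h))]
  · have hset : Finset.univ.filter (fun F : Finset α =>
        ((relax M H hH).IsFlat F ∧ (F : Set α) ≠ M.E) ∧ (F : Set α) ⊆ H) =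
          (Finset.univ.filter (fun F : Finset α => (F : Set α) ⊆ H ∧ F.card + 1 < rank M)) ∪
          (Finset.powersetCard (rank M - 1) H.toFinset) := by
      ext F
      simp only [Finset.mem_filter, Finset.mem_univ, true_and, Finset.mem_union,
        Finset.mem_powersetCard]
      rw [← Finset.coe_subset, Set.coe_toFinset, ← Set.ncard_coe_finset]
      constructor
      · rintro ⟨h1, h2⟩
        have := (hH.proper_flat_relax_iff h2).1 h1
        by_cases h3 : (F : Set α).ncard + 1 < rank M
        · exact Or.inl ⟨h2, h3⟩
        · exact Or.inr ⟨h2, by omega⟩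
      · rintro (⟨h1, h2⟩ | ⟨h1, h2⟩)
        · exact ⟨(hH.proper_flat_relax_iff h1).2 (by omega), h1⟩
        · exact ⟨(hH.proper_flat_relax_iff h1).2 (by omega), h1⟩
    rw [hset, Finset.sum_union]
    · congr 1
      · refine Finset.sum_congr rfl fun F hF => ?_
        simp only [Finset.mem_filter, Finset.mem_univ, true_and] at hF
        rw [hH.inverseKL_restrict_relax hF.1 (by rw [Set.ncard_coe_finset]; omega), mul_one,
          hH.rk_relax_of_subset hF.1, Set.ncard_coe_finset, min_eq_left (by omega)]
      · rw [Finset.sum_congr rfl (g := fun _ => (-1) ^ (rank M - 1) * (1 - X)),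
          Finset.sum_const, Finset.card_powersetCard, ← Set.ncard_eq_toFinset_card', nsmul_eq_mul]
        · simp only [map_mul, map_pow, map_neg, map_one, map_natCast]
          ring
        · intro F hF
          rw [Finset.mem_powersetCard, ← Finset.coe_subset, Set.coe_toFinset] at hF
          have hcard : (F : Set α).ncard = rank M - 1 := by rw [Set.ncard_coe_finset, hF.2]
          have hlt : (F : Set α).ncard < rank M := by omega
          have hrkF : rk (relax M H hH) F = rank M - 1 := by
            rw [hH.rk_relax_of_subset hF.1]
            omega
          rw [hH.inverseKL_restrict_relax hF.1 hlt, mul_one, hrkF]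
          congr 1
          have h := chiRev_hyperplane (relax M H hH)
            ((hH.proper_flat_relax_iff hF.1).2 hlt).1 (by rw [hH.rank_relax]; omega)
          exact h
    · rw [Finset.disjoint_left]
      intro F hF hF'
      rw [Finset.mem_filter] at hF
      rw [Finset.mem_powersetCard] at hF'
      omega

/-- The difference of the recursions for the relaxation and for the matroid. -/
theorem properSum_relax_sub :
    properSum inverseKL (relax M H hH) - properSum inverseKL M = (X - 1) *
      (∑ F ∈ Finset.univ.filter (fun F : Finset α => (F : Set α) ⊆ H ∧ F.card + 1 < rank M),
        (-1) ^ F.card * ∑ A ∈ (between F H).filter (fun A => rank M ≤ A.card),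
          C (relSign F A) * X ^ (rank M - 1 - F.card)
      + (-1) ^ (rank M - 1) * inverseKL (M.restrict H)
      - C ((-1) ^ (rank M - 1) * (H.ncard.choose (rank M - 1) : ℤ))) := by
  have hdiff : ∑ F ∈ Finset.univ.filter (fun F : Finset α =>
        (F : Set α) ⊆ H ∧ F.card + 1 < rank M), (-1) ^ F.card * chiRev (relax M H hH) F M.E -
      ∑ F ∈ Finset.univ.filter (fun F : Finset α => (F : Set α) ⊆ H ∧ F.card + 1 < rank M),
        (-1) ^ F.card * chiRev M F M.E = (X - 1) *
      ∑ F ∈ Finset.univ.filter (fun F : Finset α => (F : Set α) ⊆ H ∧ F.card + 1 < rank M),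
        (-1) ^ F.card * ∑ A ∈ (between F H).filter (fun A => rank M ≤ A.card),
          C (relSign F A) * X ^ (rank M - 1 - F.card) := by
    rw [← Finset.sum_sub_distrib, Finset.mul_sum]
    refine Finset.sum_congr rfl fun F hF => ?_
    simp only [Finset.mem_filter, Finset.mem_univ, true_and] at hF
    rw [← mul_sub, hH.chiRev_relax_sub hF.1 hF.2]
    ring
  rw [hH.properSum_eq_of_stressed, hH.properSum_relax_eq]
  linear_combination hdiff

theorem coeff_inverseKL_relax (hle : rank M ≤ H.ncard) (i : ℕ) :
    (inverseKL (relax M H hH)).coeff i = (inverseKL M).coeff i +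
      if 2 * i < rank M then (sytBar (H.ncard + 2 - rank M) i (rank M - 2 * i - 1) : ℤ) else 0 := by
  have hrk := hH.rk_add_one
  have hpos : 0 < rank M := by omega
  rw [coeff_inverseKL (by rw [hH.rank_relax]; exact hpos), coeff_inverseKL hpos, hH.rank_relax]
  split_ifs with hi
  swap
  · simp
  rw [sytBar_eq_altSum hle hi, ← mul_add]
  congr 1
  rw [← sub_eq_iff_eq_add', ← coeff_sub, hH.properSum_relax_sub]
  set V := ∑ F ∈ Finset.univ.filter (fun F : Finset α => (F : Set α) ⊆ H ∧ F.card + 1 < rank M),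
        (-1) ^ F.card * ∑ A ∈ (between F H).filter (fun A => rank M ≤ A.card),
          C (relSign F A) * X ^ (rank M - 1 - F.card) with hV
  -- The cofactor of X - 1 has alternating sums as coefficients; the factor itself then takes
  -- differences of neighbouring ones.
  have hW : ∀ j, 2 * j < rank M → (V + (-1) ^ (rank M - 1) * inverseKL (M.restrict H)
      - C ((-1) ^ (rank M - 1) * (H.ncard.choose (rank M - 1) : ℤ))).coeff j =
        -altSum H.ncard (rank M) j := by
    intro j hj
    have h2 : (((-1) ^ (rank M - 1) : ℤ[X])) = C ((-1) ^ (rank M - 1)) := by simp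
    have hQ : (inverseKL (M.restrict H)).coeff j = (-1) ^ rank M *
        (altSum H.ncard (rank M - 1) j - altSum H.ncard (rank M - 1) (rank M - 1 - j)) := by
      rw [hH.isUniform_restrict.coeff_inverseKL (by omega), Nat.sub_add_cancel hpos]
      split_ifs with h
      · rfl
      -- In the middle degree 2j = rk M - 1 the polynomial of the restriction has no coefficient,
      -- and the formula gives zero as well.
      · rw [show rank M - 1 - j = j by omega, sub_self, mul_zero]
    rw [coeff_sub, coeff_add, hV, hH.coeff_sum_small hle (by omega), h2, coeff_C_mul, hQ]
    -- The constant coming from the new hyperplanes supplies exactly the value at j = 0 that is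
    -- missing from the small flats.
    have hVC : ((if 0 < j then -altSum H.ncard (rank M) (rank M - 1 - j) else 0) -
        (C ((-1) ^ (rank M - 1) * (H.ncard.choose (rank M - 1) : ℤ))).coeff j : ℤ) =
        -altSum H.ncard (rank M) (rank M - 1 - j) := by
      rw [coeff_C]
      cases j with
      | zero =>
        have := altSum_succ H.ncard (rank M - 1) (rank M - 1)
        rw [Nat.sub_add_cancel hpos, altSum_eq_zero _ le_rfl] at this
        simp [this]
      | succ j => simp
    obtain ⟨k, hk⟩ : ∃ k, rank M = k + 1 := ⟨rank M - 1, by omega⟩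
    rw [hk, add_tsub_cancel_right] at hVC ⊢
    have h3 : (k.choose (k - j) : ℤ) = k.choose j := by rw [Nat.choose_symm (by omega)]
    have h4 := altSum_succ H.ncard k (k - j)
    have h5 := altSum_succ H.ncard k j
    rw [h3] at h4
    have hs : ((-1) ^ k * (-1) ^ k : ℤ) = 1 := by
      rw [← mul_pow]; simp
    rw [pow_succ]
    linear_combination hVC - h4 + h5 - (altSum H.ncard k j - altSum H.ncard k (k - j)) * hs
  rw [sub_mul, one_mul, coeff_sub, hW i hi]
  cases i with
  | zero => simp
  | succ i =>
    rw [coeff_X_mul, hW i (by omega), if_neg (by omega), add_tsub_cancel_right]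
    ring

end IsStressedHyperplane

end Relaxation

/-! ### A stressed hyperplane for all admissible parameters -/

section PointedUniform

variable {α : Type u} [Fintype α]

/-- The direct sum of a coloop `x` and a uniform matroid: the bases are the sets of cardinality `k`
that contain `x`. -/
def pointedUniform (x : α) (k : ℕ) (hk : 1 ≤ k) (hkn : k ≤ Nat.card α) : Matroid α :=
  Matroid.ofIsBaseOfFinite (E := Set.univ) (Set.toFinite _) (fun B => x ∈ B ∧ B.ncard = k)
    (by
      obtain ⟨B, hxB, -, hB⟩ := Set.exists_subsuperset_card_eq (n := k) (Set.subset_univ {x})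
        (by rwa [Set.ncard_singleton]) (by rwa [Set.ncard_univ])
      exact ⟨B, hxB rfl, hB⟩)
    (fun A B hA hB a ha => by
      obtain ⟨b, hb⟩ := exists_mem_diff_of_ncard_eq (hA.2.trans hB.2.symm) ha
      refine ⟨b, hb, Or.inr ⟨hA.1, ?_⟩, (ncard_exchange ha.1 hb.2).trans hA.2⟩
      rintro rfl
      exact ha.2 hB.1)
    (fun _ _ => Set.subset_univ _)

variable {x : α} {k : ℕ} {hk : 1 ≤ k} {hkn : k ≤ Nat.card α}

theorem pointedUniform_indep_iff (I : Set α) :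
    (pointedUniform x k hk hkn).Indep I ↔ (insert x I).ncard ≤ k := by
  rw [Matroid.indep_iff]
  constructor
  · rintro ⟨B, ⟨hxB, hB⟩, hIB⟩
    rw [← hB]
    exact Set.ncard_le_ncard (Set.insert_subset hxB hIB) (Set.toFinite _)
  · intro h
    obtain ⟨B, hIB, -, hB⟩ := Set.exists_subsuperset_card_eq (Set.subset_univ (insert x I)) h
      (by rwa [Set.ncard_univ])
    exact ⟨B, ⟨hIB (Set.mem_insert _ _), hB⟩, (Set.subset_insert _ _).trans hIB⟩

theorem pointedUniform_indep_iff_of_notMem {I : Set α} (hI : x ∉ I) :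
    (pointedUniform x k hk hkn).Indep I ↔ I.ncard ≤ k - 1 := by
  rw [pointedUniform_indep_iff, Set.ncard_insert_of_notMem hI (Set.toFinite _)]
  omega

theorem rank_pointedUniform : rank (pointedUniform x k hk hkn) = k := by
  obtain ⟨B, hB⟩ := (pointedUniform x k hk hkn).exists_isBase
  rw [← ncard_of_isBase hB]
  exact hB.2

theorem ncard_compl_singleton (x : α) : ({x}ᶜ : Set α).ncard + 1 = Nat.card α := by
  have := Set.ncard_add_ncard_compl {x}
  rw [Set.ncard_singleton] at this
  omega

/-- Away from the coloop `x` independence only bounds the cardinality by k - 1, so the complement of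
`x` is uniform of corank one and its subsets of size `k` are circuits. -/
theorem isStressedHyperplane_pointedUniform :
    IsStressedHyperplane (pointedUniform x k hk hkn) {x}ᶜ := by
  have hrk : rk (pointedUniform x k hk hkn) {x}ᶜ = k - 1 := by
    rw [rk_eq_of_indep_iff _ {x}ᶜ (k - 1)
      (fun I hI => pointedUniform_indep_iff_of_notMem (fun h => hI h rfl))]
    have := ncard_compl_singleton x
    omega
  refine ⟨(isFlat_iff_rk _).2 ⟨Set.subset_univ _, fun e he => ?_⟩, ?_, fun S hS hcard => ?_⟩
  · have hex : e = x := by simpa using he.2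
    have huniv : insert x {x}ᶜ = (pointedUniform x k hk hkn).E := by
      refine Set.eq_univ_of_forall fun y => ?_
      simpa using em (y = x)
    rw [hex, huniv, hrk, ← rank, rank_pointedUniform]
    omega
  · rw [hrk, rank_pointedUniform]
    omega
  · rw [rank_pointedUniform] at hcard
    have hxS : x ∉ S := fun h => hS h rfl
    rw [Matroid.isCircuit_iff_dep_forall_sdiff_singleton_indep, Matroid.dep_iff,
      pointedUniform_indep_iff_of_notMem hxS]
    refine ⟨⟨by omega, Set.subset_univ _⟩, fun e he => ?_⟩
    rw [pointedUniform_indep_iff_of_notMem (fun h => hxS h.1)]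
    have := Set.ncard_sdiff_singleton_add_one he (Set.toFinite S)
    omega

end PointedUniform

/-! ### The relaxation polynomial: existence, uniqueness and degree -/

theorem isRelaxationPolynomial_sytBar {k h : ℕ} (hk : 1 ≤ k) (hh : 1 ≤ h) :
    IsRelaxationPolynomial.{u} k h (∑ i ∈ Finset.range ((k + 1) / 2),
      C (sytBar (h + 2 - k) i (k - 2 * i - 1) : ℤ) * X ^ i) := by
  intro α _ M H hH hM hHh
  have : Fintype α := Fintype.ofFinite α
  subst hM hHh
  by_cases hle : rank M ≤ H.ncard
  · ext i
    rw [hH.coeff_inverseKL_relax hle, coeff_add, coeff_sum_range_C_mul]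
    congr 1
    by_cases hi : 2 * i < rank M
    · rw [if_pos hi, if_pos (by omega)]
    · rw [if_neg hi, if_neg (by omega)]
  · have h1 := hH.rk_add_one
    have h2 := rk_le_ncard M H
    rw [hH.relax_eq_self (by omega), left_eq_add]
    refine Finset.sum_eq_zero fun i hi => ?_
    rw [Finset.mem_range] at hi
    -- Here k = h + 1 and the first column has height 1. The exceptional single box would need k =
    -- 1, hence h = 0, which h ≥ 1 rules out.
    rw [show H.ncard + 2 - rank M = 1 by omega, sytBar_one (by omega)]
    simp

/-- One matroid with these parameters suffices to recover the polynomial as a difference. `ULift`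
places it in the universe over which the defining property quantifies. -/
theorem isRelaxationPolynomial_unique {k h : ℕ} (hk : 1 ≤ k) (hkh : k ≤ h + 1) {p q : ℤ[X]}
    (hp : IsRelaxationPolynomial.{u} k h p) (hq : IsRelaxationPolynomial.{u} k h q) : p = q := by
  have hcard : Nat.card (ULift.{u} (Fin (h + 1))) = h + 1 := by simp
  have hH : IsStressedHyperplane (pointedUniform (⟨0⟩ : ULift.{u} (Fin (h + 1))) k hk
    (by rwa [hcard])) {⟨0⟩}ᶜ := isStressedHyperplane_pointedUniform
  have hncard := ncard_compl_singleton (⟨0⟩ : ULift.{u} (Fin (h + 1)))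
  have h1 := hp _ _ _ hH rank_pointedUniform (by omega)
  have h2 := hq _ _ _ hH rank_pointedUniform (by omega)
  exact add_left_cancel (h1.symm.trans h2)

/-- For h ≥ k the first column has height at least 2, so every count up to the top index is
positive. -/
theorem degree_sum_sytBar {k h : ℕ} (hk : 1 ≤ k) (hkh : k ≤ h) :
    (∑ i ∈ Finset.range ((k + 1) / 2),
      C (sytBar (h + 2 - k) i (k - 2 * i - 1) : ℤ) * X ^ i : ℤ[X]).degree =
      (((k - 1) / 2 : ℕ) : WithBot ℕ) := by
  refine degree_eq_of_le_of_coeff_ne_zero ?_ ?_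
  · rw [degree_le_iff_coeff_zero]
    intro m hm
    rw [Nat.cast_lt] at hm
    rw [coeff_sum_range_C_mul, if_neg (by omega)]
  · rw [coeff_sum_range_C_mul, if_pos (by omega), show h + 2 - k = h - k + 2 by omega]
    exact_mod_cast (sytBar_pos _ _ _).ne'

end MatroidKL

end

theorem mainTheorem12 :
    (∀ (k n : ℕ) (hkn : k ≤ n), 1 ≤ n →
      MatroidKL.inverseKL (MatroidKL.uniform k n hkn) =
        ∑ i ∈ Finset.range ((k + 1) / 2),
          C (MatroidKL.syt (n - k + 1) i (k - 2 * i - 1) : ℤ) * X ^ i) ∧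
    (∀ k h : ℕ, 1 ≤ k → 1 ≤ h → k ≤ h + 1 →
      ∃ q : ℤ[X],
        (∀ p : ℤ[X], MatroidKL.IsRelaxationPolynomial.{u} k h p ↔ p = q) ∧
        q = ∑ i ∈ Finset.range ((k + 1) / 2),
          C (MatroidKL.sytBar (h + 2 - k) i (k - 2 * i - 1) : ℤ) * X ^ i ∧
        (∀ m : ℕ, 0 ≤ q.coeff m) ∧
        (k ≤ h → q.degree = (((k - 1) / 2 : ℕ) : WithBot ℕ))) := by
  refine ⟨fun k n hkn hn => (MatroidKL.isUniform_uniform k n hkn).inverseKL_eq hn,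
    fun k h hk hh hkh => ⟨_, fun p => ⟨fun hp => ?_, ?_⟩, rfl, fun m => ?_, fun hle => ?_⟩⟩
  · exact MatroidKL.isRelaxationPolynomial_unique hk hkh hp
      (MatroidKL.isRelaxationPolynomial_sytBar hk hh)
  · rintro rfl
    exact MatroidKL.isRelaxationPolynomial_sytBar hk hh
  · rw [MatroidKL.coeff_sum_range_C_mul]
    split_ifs <;> positivity
  · exact MatroidKL.degree_sum_sytBar hk hle
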